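/- Let $S^1=\mathbb R/\mathbb Z$, and call a point of $S^1$ dyadic if it is represented by an element of $\mathbb Z[1/2]=\{a/2^n : a\in\mathbb Z,\ n\ge 0\}$. Let $T$ be Thompson's group $T$: the group, under composition, of all orientation-preserving piecewise linear homeomorphisms of $S^1$ that map the set of dyadic points onto itself, are differentiable except at finitely many points, all of which are dyadic, and whose slopes are integral powers of $2$. Let $R\le T$ be the subgroup of the rotations $x\mapsto x+q$ with $q\in\mathbb Z[1/2]$. On the group $\mathbb Z[1/2]/\mathbb Z$ of dyadic rationals modulo $1$ consider the 2-adic metric $d$ given by $d(x,x)=0$ and, for $x\ne y$, by $d(x,y)=2^k$, where $x-y$ is represented by $r/2^k$ with $r$ odd and $k\ge 1$. Then the following hold. (1) $T$ is finitely generated. (2) Sending the rotation $x\mapsto x+q$ to the class of $q$ is a well-defined isomorphism from $R$ onto $\mathbb Z[1/2]/\mathbb Z$. (3) If $R$ carries the metric obtained from $d$ through this isomorphism, then the inclusion $R\hookrightarrow T$ is a quasi-isometric embedding for the word metric of every finite generating set of $T$. That is, for every finite generating set $S$ of $T$, with word metric $d_S(g,h)=|g^{-1}h|_S$, there are constants $K\ge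 1$ and $C\ge 0$ such that for all $g,h\in R$ $$\frac1K\,d(g,h)-C\ \le\ d_S(g,h)\ \le\ K\,d(g,h)+C .$$ -/

import Mathlib

open Filter Topology

noncomputable section

namespace ThompsonT

/-! ### Dyadic rationals and dyadic rationals modulo one -/

/-- The additive group `ℤ[1/2]` of dyadic rationals `a / 2 ^ n`. -/
def dyadicRationals : AddSubgroup ℚ where
  carrier := {q | ∃ (a : ℤ) (n : ℕ), q = a / 2 ^ n}
  zero_mem' := ⟨0, 0, by simp⟩
  add_mem' := by
    rintro _ _ ⟨a, n, rfl⟩ ⟨b, m, rfl⟩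
    refine ⟨a * 2 ^ m + b * 2 ^ n, n + m, ?_⟩
    push_cast
    field_simp
    ring
  neg_mem' := by
    rintro _ ⟨a, n, rfl⟩
    exact ⟨-a, n, by push_cast; ring⟩

/-- The integers, as a subgroup of the dyadic rationals. -/
def integersInDyadic : AddSubgroup dyadicRationals :=
  (AddSubgroup.zmultiples (1 : ℚ)).addSubgroupOf dyadicRationals

/-- The group `ℤ[1/2] / ℤ` of dyadic rationals modulo `1`. -/
abbrev DyadicModOne : Type := dyadicRationals ⧸ integersInDyadic

theorem mem_integersInDyadic {q : dyadicRationals} :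
    q ∈ integersInDyadic ↔ ∃ n : ℤ, (n : ℚ) = q := by
  simp [integersInDyadic, AddSubgroup.mem_addSubgroupOf, AddSubgroup.mem_zmultiples_iff]

/-- The reduced denominator of a dyadic rational modulo `1`. -/
def modDen : DyadicModOne → ℕ :=
  Quotient.lift (fun q : dyadicRationals => (q : ℚ).den) (by
    intro a b h
    obtain ⟨n, hn⟩ := mem_integersInDyadic.1 (QuotientAddGroup.leftRel_apply.1 h)
    have hb : (b : ℚ) = a + n := by
      rw [hn]; push_cast; ring
    change (a : ℚ).den = (b : ℚ).den
    rw [hb, Rat.add_intCast_den])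

open Classical in
/-- The 2-adic metric on `ℤ[1/2] / ℤ`: if `x ≠ y` and `x - y` is represented by the reduced fraction
`r / 2 ^ k`, then the distance of `x` and `y` is `2 ^ k`. -/
def twoAdicDist (x y : DyadicModOne) : ℝ :=
  if x = y then 0 else (modDen (x - y) : ℝ)

theorem modDen_mk (q : dyadicRationals) : modDen (q : DyadicModOne) = (q : ℚ).den := rfl

theorem den_odd_div_two_pow {r : ℤ} (hr : Odd r) (k : ℕ) : ((r : ℚ) / 2 ^ k).den = 2 ^ k := by
  have h := Rat.den_div_eq_of_coprime (a := r) (b := 2 ^ k) (by positivity)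
    (by
      rw [Int.natAbs_pow]
      exact Nat.Coprime.pow_right _ ((Nat.coprime_two_right).2 (Int.natAbs_odd.2 hr)))
  have h2 : ((r : ℚ) / ((2 ^ k : ℤ) : ℚ)) = (r : ℚ) / 2 ^ k := by push_cast; rfl
  rw [h2] at h
  exact_mod_cast h

/-- The defining property of the 2-adic metric, on representatives. -/
theorem twoAdicDist_eq (x y : dyadicRationals) (r : ℤ) (k : ℕ) (hr : Odd r) (hk : 1 ≤ k)
    (h : |(x : ℚ) - y| = r / 2 ^ k) :
    twoAdicDist (x : DyadicModOne) (y : DyadicModOne) = 2 ^ k := by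
  have hden : ((x : ℚ) - y).den = 2 ^ k := by
    rcases abs_choice ((x : ℚ) - y) with h' | h'
    · rw [← h', h, den_odd_div_two_pow hr]
    · rw [← Rat.neg_den, ← h', h, den_odd_div_two_pow hr]
  have hne : (x : DyadicModOne) ≠ (y : DyadicModOne) := by
    intro hxy
    obtain ⟨n, hn⟩ := mem_integersInDyadic.1 (QuotientAddGroup.eq.1 hxy)
    have h1 : ((x : ℚ) - y) = ((-n : ℤ) : ℚ) := by
      push_cast; rw [hn]; push_cast; ring
    rw [h1, Rat.den_intCast] at hden
    exact absurd hden (Nat.one_lt_two_pow (by omega)).ne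
  rw [twoAdicDist, if_neg hne, ← QuotientAddGroup.mk_sub, modDen_mk, AddSubgroup.coe_sub, hden]
  push_cast; rfl

theorem modDen_eq_two_pow (x : DyadicModOne) : ∃ k : ℕ, modDen x = 2 ^ k := by
  induction x using QuotientAddGroup.induction_on with
  | H q =>
    obtain ⟨q, a, n, rfl⟩ := q
    have h : (((a : ℚ) / 2 ^ n).den : ℤ) ∣ 2 ^ n := by
      have := Rat.den_dvd a (2 ^ n)
      rw [Rat.divInt_eq_div] at this
      push_cast at this
      exact this
    have h' : ((a : ℚ) / 2 ^ n).den ∣ 2 ^ n := by exact_mod_cast h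
    obtain ⟨k, -, hk⟩ := (Nat.dvd_prime_pow Nat.prime_two).1 h'
    exact ⟨k, hk⟩

theorem modDen_neg (x : DyadicModOne) : modDen (-x) = modDen x := by
  induction x using QuotientAddGroup.induction_on with
  | H q => exact Rat.neg_den _

theorem modDen_add_le (x y : DyadicModOne) : modDen (x + y) ≤ max (modDen x) (modDen y) := by
  obtain ⟨i, hi⟩ := modDen_eq_two_pow x
  obtain ⟨j, hj⟩ := modDen_eq_two_pow y
  have h : modDen (x + y) ∣ Nat.lcm (modDen x) (modDen y) := by
    induction x using QuotientAddGroup.induction_on with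
    | H q =>
      induction y using QuotientAddGroup.induction_on with
      | H p => exact Rat.add_den_dvd_lcm _ _
  rcases le_total i j with hij | hij
  · have hd : modDen x ∣ modDen y := by rw [hi, hj]; exact pow_dvd_pow 2 hij
    rw [Nat.lcm_eq_right hd] at h
    exact le_max_of_le_right (Nat.le_of_dvd (by rw [hj]; positivity) h)
  · have hd : modDen y ∣ modDen x := by rw [hi, hj]; exact pow_dvd_pow 2 hij
    rw [Nat.lcm_eq_left hd] at h
    exact le_max_of_le_left (Nat.le_of_dvd (by rw [hi]; positivity) h)

theorem twoAdicDist_self (x : DyadicModOne) : twoAdicDist x x = 0 := by simp [twoAdicDist]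

theorem twoAdicDist_nonneg (x y : DyadicModOne) : 0 ≤ twoAdicDist x y := by
  unfold twoAdicDist; split_ifs <;> positivity

theorem twoAdicDist_comm (x y : DyadicModOne) : twoAdicDist x y = twoAdicDist y x := by
  by_cases h : x = y
  · rw [h]
  · rw [twoAdicDist, twoAdicDist, if_neg h, if_neg (Ne.symm h), ← neg_sub y x, modDen_neg]

theorem eq_of_twoAdicDist_eq_zero {x y : DyadicModOne} (h : twoAdicDist x y = 0) : x = y := by
  by_contra hne
  rw [twoAdicDist, if_neg hne] at h
  obtain ⟨k, hk⟩ := modDen_eq_two_pow (x - y)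
  rw [hk] at h
  simp at h

theorem twoAdicDist_triangle (x y z : DyadicModOne) :
    twoAdicDist x z ≤ twoAdicDist x y + twoAdicDist y z := by
  by_cases hxy : x = y
  · subst hxy; simp [twoAdicDist_self]
  by_cases hyz : y = z
  · subst hyz; simp [twoAdicDist_self]
  by_cases hxz : x = z
  · subst hxz
    rw [twoAdicDist_self]
    exact add_nonneg (twoAdicDist_nonneg _ _) (twoAdicDist_nonneg _ _)
  rw [twoAdicDist, twoAdicDist, twoAdicDist, if_neg hxy, if_neg hyz, if_neg hxz]
  have h := modDen_add_le (x - y) (y - z)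
  rw [sub_add_sub_cancel] at h
  have h2 : modDen (x - z) ≤ modDen (x - y) + modDen (y - z) :=
    h.trans (max_le (Nat.le_add_right _ _) (Nat.le_add_left _ _))
  exact_mod_cast h2

/-! ### Thompson's group `T` -/

/-- The point of the circle `ℝ / ℤ` represented by a dyadic rational. -/
def dyadicPoint (q : dyadicRationals) : UnitAddCircle := (((q : ℚ) : ℝ) : UnitAddCircle)

/-- The points of the circle `ℝ / ℤ` that are represented by dyadic rationals. -/
def IsDyadicPoint (x : UnitAddCircle) : Prop := ∃ q : dyadicRationals, x = dyadicPoint q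

/-- Near the point `x` of the circle, the map `f` is affine with slope an integral power of `2`. -/
def IsAffineNear (f : UnitAddCircle → UnitAddCircle) (x : UnitAddCircle) : Prop :=
  ∃ k : ℤ, ∀ᶠ t : ℝ in 𝓝 0,
    f (x + (t : UnitAddCircle)) = f x + (((2 : ℝ) ^ k * t : ℝ) : UnitAddCircle)

/-- Thompson's group `T`: the homeomorphisms of the circle `ℝ / ℤ` that preserve the set of dyadic
points and that, away from finitely many points, all of them dyadic, are locally affine with slope
an integral power of `2`. The slopes are positive, so these homeomorphisms preserve orientation.
The product is composition. -/
def T : Subgroup (UnitAddCircle ≃ₜ UnitAddCircle) where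
  carrier := {f | (∀ x, IsDyadicPoint (f x) ↔ IsDyadicPoint x) ∧
    ∃ B : Set UnitAddCircle, B.Finite ∧ (∀ b ∈ B, IsDyadicPoint b) ∧ ∀ x ∉ B, IsAffineNear f x}
  one_mem' := ⟨fun _ => Iff.rfl, ∅, Set.finite_empty, by simp, fun x _ => ⟨0, by simp⟩⟩
  mul_mem' := by
    rintro f g ⟨hf, A, hA, hA', hfA⟩ ⟨hg, B, hB, hB', hgB⟩
    refine ⟨fun x => (hf (g x)).trans (hg x), B ∪ g ⁻¹' A,
      hB.union (hA.preimage g.injective.injOn), ?_, ?_⟩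
    · rintro b (hb | hb)
      · exact hB' b hb
      · exact (hg b).1 (hA' _ hb)
    · intro x hx
      obtain ⟨k, hk⟩ := hgB x (fun h => hx (Or.inl h))
      obtain ⟨l, hl⟩ := hfA (g x) (fun h => hx (Or.inr h))
      refine ⟨l + k, ?_⟩
      have ht : Tendsto (fun t : ℝ => (2 : ℝ) ^ k * t) (𝓝 0) (𝓝 0) := by
        have : Continuous (fun t : ℝ => (2 : ℝ) ^ k * t) := by fun_prop
        simpa using this.tendsto 0
      filter_upwards [hk, ht.eventually hl] with t h1 h2
      change f (g _) = f (g x) + _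
      rw [h1, h2, zpow_add₀ (by norm_num), mul_assoc]
  inv_mem' := by
    rintro f ⟨hf, A, hA, hA', hfA⟩
    refine ⟨fun x => ?_, f '' A, hA.image f, ?_, ?_⟩
    · change IsDyadicPoint (f.symm x) ↔ _
      rw [← hf, f.apply_symm_apply]
    · rintro _ ⟨a, ha, rfl⟩
      exact (hf a).2 (hA' a ha)
    · intro y hy
      obtain ⟨k, hk⟩ := hfA (f.symm y) (fun h => hy ⟨_, h, f.apply_symm_apply y⟩)
      refine ⟨-k, ?_⟩
      have ht : Tendsto (fun t : ℝ => (2 : ℝ) ^ (-k) * t) (𝓝 0) (𝓝 0) := by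
        have : Continuous (fun t : ℝ => (2 : ℝ) ^ (-k) * t) := by fun_prop
        simpa using this.tendsto 0
      filter_upwards [ht.eventually hk] with t h1
      change f.symm _ = f.symm y + _
      rw [f.symm_apply_eq, h1, f.apply_symm_apply, ← mul_assoc, ← zpow_add₀ (by norm_num)]
      simp

/-- The subgroup `R` of `T` of the rotations of the circle by dyadic rationals. -/
def R : Subgroup T where
  carrier := {g | ∃ q : dyadicRationals, ∀ x, g.1 x = x + dyadicPoint q}
  one_mem' := ⟨0, fun x => by simp [dyadicPoint]⟩
  mul_mem' := by
    rintro f g ⟨p, hp⟩ ⟨q, hq⟩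
    refine ⟨q + p, fun x => ?_⟩
    change f.1 (g.1 x) = _
    rw [hq, hp, add_assoc]
    simp [dyadicPoint]
  inv_mem' := by
    rintro f ⟨p, hp⟩
    refine ⟨-p, fun x => ?_⟩
    change f.1.symm x = _
    rw [f.1.symm_apply_eq, hp]
    simp [dyadicPoint]

/-! ### Word metrics and quasi-isometric embeddings -/

/-- The word length of `g` with respect to a generating set `S` of the group: the least length of
a word in the elements of `S` and their inverses that represents `g`. -/
def wordLength {G : Type*} [Group G] (S : Set G) (g : G) : ℕ :=
  sInf {n | ∃ w : List G, (∀ s ∈ w, s ∈ S ∨ s⁻¹ ∈ S) ∧ w.prod = g ∧ w.length = n}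

/-- The word metric with respect to a generating set `S` of the group. -/
def wordDist {G : Type*} [Group G] (S : Set G) (g h : G) : ℝ := wordLength S (g⁻¹ * h)

/-- `f` is a quasi-isometric embedding for the metrics `dX` and `dY`. -/
def IsQuasiIsometricEmbedding {X Y : Type*} (dX : X → X → ℝ) (dY : Y → Y → ℝ) (f : X → Y) : Prop :=
  ∃ K C : ℝ, 1 ≤ K ∧ 0 ≤ C ∧ ∀ x y,
    1 / K * dX x y - C ≤ dY (f x) (f y) ∧ dY (f x) (f y) ≤ K * dX x y + C

end ThompsonT

end

noncomputable section

namespace ThompsonT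

/-! ### Towers of cyclic elements -/

/-! Lift `T` to homeomorphisms of the line commuting with the unit translation. A left vine with `n
+ 1` leaves identifies the circle with one of length `n + 1`, and conjugating the unit translation
by it gives `vineRot n`, written `c n` below. In `T` it permutes the leaves cyclically, so its `(n +
1)`-st power is trivial; in the lift that power is the unit translation `c 0`. The two relations of
`CyclicTower` are all that the word estimates use.

Upper bound. The ratios `x j = c (j + 1) * (c j)⁻¹` satisfy the Thompson relation `x 1 * x j = x (j
+ 1) * x 1` for `j ≥ 2`, so every later ratio is a conjugate of `x 2` by a power of `x 1`.
Descending products of many ratios therefore telescope to words of linear length, which bounds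
powers of `c n` linearly in `n` (`length_pow_le`). Passing from the vine with `n + 1` leaves to the
one with `2 * n + 2` leaves by halving all leaves costs one such product. Doubling `k` times reaches
the complete binary tree, and the costs form a geometric series of size `2 ^ k`. The rotation by `s
/ 2 ^ k` is `c (2 ^ k - 1) ^ s` conjugated by `completeTree`, so its length is `O(2 ^ k)`
(`length_conj_le`).

Lower bound. Count the standard dyadic arcs that `g` does not carry affinely onto a standard dyadic
arc. The count is finite and subadditive, hence at most a constant times word length. Rotation by an
odd multiple of `1 / 2 ^ (m + 1)` moves each of the `2 ^ m` arcs of depth `m` by half its length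
modulo its length, so all of them are bad (`two_pow_le_ncard_badArcs`).

Generation. An element of `T` is affine on the arcs of a fine subdivision. Splitting source leaves
whose images are too long makes all images equally long, and each split is absorbed by some `c n`
(`exists_lift`). Finally `c 1`, `c 2`, `c 3` produce every `c n`. -/

/-- A sequence of elements of a group that satisfies the relations between the elements of `T`
that cyclically permute the leaves of the left vines. -/
structure CyclicTower {G : Type*} [Group G] (c : ℕ → G) : Prop where
  pow_succ_eq : ∀ n, c n ^ (n + 1) = c 0
  shift : ∀ n j, 1 ≤ j → j ≤ n →
    (c (n + 2) ^ (j + 1))⁻¹ * c (n + 1) ^ j = (c (n + 1) ^ (j + 1))⁻¹ * c n ^ j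

section Tower

variable {G : Type*} [Group G]

/-- The quotients of successive elements of a tower. -/
def ratio (c : ℕ → G) (j : ℕ) : G := c (j + 1) * (c j)⁻¹

/-- The descending product of the first ratios. -/
def ratioProd (c : ℕ → G) : ℕ → G
  | 0 => 1
  | r + 1 => ratio c (r + 1) * ratioProd c r

/-- The descending product of the first ratios of odd index. -/
def oddRatioProd (c : ℕ → G) : ℕ → G
  | 0 => 1
  | n + 1 => ratio c (2 * n + 1) * oddRatioProd c n

/-- The element that compares the complete binary tree of depth `k` with a left vine. -/
def completeTree (c : ℕ → G) : ℕ → G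
  | 0 => 1
  | k + 1 => oddRatioProd c (2 ^ k - 1) * completeTree c k

namespace CyclicTower

variable {c : ℕ → G} (hc : CyclicTower c)
include hc

theorem commute_zero (n : ℕ) : Commute (c 0) (c n) := by
  rw [← hc.pow_succ_eq n]
  exact Commute.pow_left (Commute.refl _) _

theorem ratio_eq (j : ℕ) : ratio c j = (c (j + 1) ^ (j + 1))⁻¹ * c j ^ j := by
  have h1 : c (j + 1) * (c 0)⁻¹ = (c (j + 1) ^ (j + 1))⁻¹ := by
    rw [← hc.pow_succ_eq (j + 1), pow_succ']
    group
  have h2 : c j ^ j = c 0 * (c j)⁻¹ := by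
    rw [← hc.pow_succ_eq j, pow_succ]
    group
  rw [h2, ← h1, ratio]
  group

/-- The shift relation makes the left side independent of `n`; at `n = j` it is the ratio. -/
theorem ratio_eq_of_le {n j : ℕ} (hj : 1 ≤ j) (hn : j ≤ n) :
    (c (n + 1) ^ (j + 1))⁻¹ * c n ^ j = ratio c j := by
  induction n, hn using Nat.le_induction with
  | base => rw [hc.ratio_eq]
  | succ n hn ih => rw [hc.shift n j hj hn, ih]

theorem pow_succ_mul_ratio {n j : ℕ} (hj : 1 ≤ j) (hn : j ≤ n) :
    c (n + 1) ^ (j + 1) * ratio c j = c n ^ j := by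
  rw [← hc.ratio_eq_of_le hj hn, mul_inv_cancel_left]

/-- The defining relation of Thompson's group `F`. Each ratio is rewritten at a level `n` chosen so
that powers of the same `c` cancel, which leaves one instance of the shift relation. -/
theorem ratio_one_mul_ratio {j : ℕ} (hj : 2 ≤ j) :
    ratio c 1 * ratio c j = ratio c (j + 1) * ratio c 1 := by
  obtain ⟨j, rfl⟩ : ∃ i, j = i + 1 := ⟨j - 1, by omega⟩
  have h := hc.shift (j + 1) j (by omega) (by omega)
  have e1 := hc.ratio_eq_of_le (n := j + 2) (j := 1) (by omega) (by omega)
  have e2 := hc.ratio_eq_of_le (n := j + 1) (j := 1) (by omega) (by omega)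
  rw [pow_one] at e1 e2
  rw [← hc.ratio_eq_of_le (n := j + 1) (j := j + 1) (by omega) (by omega),
    ← hc.ratio_eq_of_le (n := j + 2) (j := j + 2) (by omega) (by omega)]
  nth_rw 1 [← e1]
  rw [← e2]
  calc _ = (c (j + 3) ^ 2)⁻¹ * ((c (j + 2) ^ (j + 1))⁻¹ * c (j + 1) ^ j) * c (j + 1) := by
        rw [pow_succ (c (j + 1)) j, pow_succ (c (j + 2)) (j + 1)]; group
    _ = (c (j + 3) ^ 2)⁻¹ * ((c (j + 3) ^ (j + 1))⁻¹ * c (j + 2) ^ j) * c (j + 1) := by rw [h]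
    _ = _ := by
        rw [pow_add (c (j + 2)) j 2, show j + 2 + 1 = j + 1 + 2 by ring,
          pow_add (c (j + 1 + 2)) (j + 1) 2]; group

theorem ratio_add_two (j : ℕ) :
    ratio c (j + 2) = ratio c 1 ^ j * ratio c 2 * (ratio c 1 ^ j)⁻¹ := by
  induction j with
  | zero => simp
  | succ j ih =>
    have h := hc.ratio_one_mul_ratio (j := j + 2) (by omega)
    rw [eq_mul_inv_of_mul_eq h.symm, ih, pow_succ']
    group

/-- Comparing `pow_succ_mul_ratio` for `j = 1` and `j = 2` gives `c (n + 3) * ratio c 2 = ratio c 1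
* c (n + 2)`. Iterating yields both finite generation and a word of linear length for each `c n`. -/
theorem add_two (n : ℕ) : c (n + 2) = ratio c 1 ^ n * c 2 * (ratio c 2 ^ n)⁻¹ := by
  induction n with
  | zero => simp
  | succ n ih =>
    have h1 := hc.pow_succ_mul_ratio (n := n + 2) (j := 1) (by omega) (by omega)
    have h2 := hc.pow_succ_mul_ratio (n := n + 2) (j := 2) (by omega) (by omega)
    have h : c (n + 3) = ratio c 1 * c (n + 2) * (ratio c 2)⁻¹ := by
      rw [eq_mul_inv_iff_mul_eq, ← mul_right_inj (c (n + 2 + 1) ^ (1 + 1)), ← mul_assoc, ← mul_assoc,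
        h1, ← pow_succ (c (n + 2 + 1)), h2, pow_one, pow_two]
    rw [h, ih, pow_succ', pow_succ (ratio c 2)]
    group

theorem pow_eq_mul_ratioProd {n : ℕ} (hn : 1 ≤ n) (r : ℕ) :
    c (n + r) ^ (r + 1) = c n * (ratioProd c r)⁻¹ := by
  induction r with
  | zero => simp [ratioProd]
  | succ r ih =>
    have h := hc.pow_succ_mul_ratio (n := n + r) (j := r + 1) (by omega) (by omega)
    rw [← add_assoc, eq_mul_inv_of_mul_eq h, ih, ratioProd]
    group

/-- Adjacent conjugating powers of `ratio c 1` in `ratio_add_two` cancel to a single inverse, so a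
product of ratios of growing length collapses to a word linear in `r`. -/
theorem ratioProd_succ (r : ℕ) :
    ratioProd c (r + 1) = ratio c 1 ^ r * ((ratio c 1)⁻¹ * ratio c 2) ^ r * ratio c 1 := by
  induction r with
  | zero => simp [ratioProd]
  | succ r ih =>
    rw [ratioProd, ih, hc.ratio_add_two, pow_succ (ratio c 1), pow_succ' ((ratio c 1)⁻¹ * _)]
    simp only [mul_assoc, inv_mul_cancel_left, mul_inv_cancel_left]

/-- The same telescoping; odd indices differ by two, so the inverse square of `ratio c 1` remains
between neighbours. -/
theorem oddRatioProd_succ (n : ℕ) :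
    oddRatioProd c (n + 1) =
      ratio c 1 ^ (2 * n + 1) * ((ratio c 1 ^ 2)⁻¹ * ratio c 2) ^ n := by
  induction n with
  | zero => simp [oddRatioProd]
  | succ n ih =>
    rw [oddRatioProd, ih, show 2 * (n + 1) + 1 = (2 * n + 1) + 2 by ring, hc.ratio_add_two,
      pow_add (ratio c 1) (2 * n + 1) 2, pow_succ' ((ratio c 1 ^ 2)⁻¹ * _)]
    simp only [mul_assoc, inv_mul_cancel_left, mul_inv_cancel_left]

/-- Since both full cycles equal `c 0`, complementary powers turn `ratio_eq_of_le` at `n = m + 1`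
into squares. This form matches the splitting of the leaf in position `2` in `split_zero_mul_split`.
-/
theorem sq_mul_inv_sq {m : ℕ} (hm : 1 ≤ m) :
    c (m + 2) ^ 2 * (c (m + 1) ^ 2)⁻¹ = ratio c m := by
  have h1 : c (m + 2) ^ 2 = (c (m + 2) ^ (m + 1))⁻¹ * c 0 := by
    rw [← hc.pow_succ_eq (m + 2), eq_inv_mul_iff_mul_eq, ← pow_add]
  have h2 : c (m + 1) ^ m = c 0 * (c (m + 1) ^ 2)⁻¹ := by
    rw [← hc.pow_succ_eq (m + 1), eq_mul_inv_iff_mul_eq, ← pow_add]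
  rw [← hc.ratio_eq_of_le (n := m + 1) hm (by omega), h1, h2, mul_assoc]

theorem mem_of_mem {K : Subgroup G} (h1 : c 1 ∈ K) (h2 : c 2 ∈ K) (h3 : c 3 ∈ K) (n : ℕ) :
    c n ∈ K := by
  match n with
  | 0 => rw [← hc.pow_succ_eq 1]; exact K.pow_mem h1 _
  | 1 => exact h1
  | n + 2 =>
    rw [hc.add_two]
    exact K.mul_mem (K.mul_mem (K.pow_mem (K.mul_mem h2 (K.inv_mem h1)) _) h2)
      (K.inv_mem (K.pow_mem (K.mul_mem h3 (K.inv_mem h2)) _))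

end CyclicTower

/-- Length functions on a group. -/
structure IsLength (l : G → ℕ) : Prop where
  one : l 1 = 0
  mul : ∀ a b, l (a * b) ≤ l a + l b
  inv : ∀ a, l a⁻¹ ≤ l a

theorem IsLength.pow {l : G → ℕ} (hl : IsLength l) (a : G) (n : ℕ) : l (a ^ n) ≤ n * l a := by
  induction n with
  | zero => simp [hl.one]
  | succ n ih =>
    rw [pow_succ]
    have := hl.mul (a ^ n) a
    linarith

theorem IsLength.pow_le {l : G → ℕ} (hl : IsLength l) {a : G} {K : ℕ} (ha : l a ≤ K) (n : ℕ) :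
    l (a ^ n) ≤ n * K := (hl.pow a n).trans (Nat.mul_le_mul_left _ ha)

/-! ### Linear length bounds for the words in a tower -/

namespace CyclicTower

variable {c : ℕ → G} (hc : CyclicTower c) {l : G → ℕ} (hl : IsLength l) {K : ℕ} (h1 : l (c 1) ≤ K)
  (hr1 : l (ratio c 1) ≤ K) (hr2 : l (ratio c 2) ≤ K)

include hc hl h1 hr1 hr2 in
theorem length_le (n : ℕ) : l (c n) ≤ (2 * n + 2) * K := by
  match n with
  | 0 => rw [← hc.pow_succ_eq 1]; simpa using hl.pow_le h1 2
  | 1 => linarith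
  | n + 2 =>
    have h2 : c 2 = ratio c 1 * c 1 := by simp [ratio]
    rw [hc.add_two]
    have e1 := hl.mul (ratio c 1 ^ n * c 2) (ratio c 2 ^ n)⁻¹
    have e2 := hl.mul (ratio c 1 ^ n) (c 2)
    have e3 := hl.mul (ratio c 1) (c 1)
    rw [← h2] at e3
    have e4 := hl.inv (ratio c 2 ^ n)
    have e5 := hl.pow_le hr1 n
    have e6 := hl.pow_le hr2 n
    linarith

include hc hl hr1 hr2 in
theorem length_ratioProd_le (r : ℕ) : l (ratioProd c r) ≤ 3 * r * K := by
  match r with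
  | 0 => simp [ratioProd, hl.one]
  | r + 1 =>
    rw [hc.ratioProd_succ]
    have e1 := hl.mul (ratio c 1 ^ r * ((ratio c 1)⁻¹ * ratio c 2) ^ r) (ratio c 1)
    have e2 := hl.mul (ratio c 1 ^ r) (((ratio c 1)⁻¹ * ratio c 2) ^ r)
    have e3 := hl.mul (ratio c 1)⁻¹ (ratio c 2)
    have e4 := hl.inv (ratio c 1)
    have e5 := hl.pow_le hr1 r
    have e6 := hl.pow_le (K := 2 * K) (a := (ratio c 1)⁻¹ * ratio c 2) (by linarith) r
    linarith

include hc hl hr1 hr2 in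
theorem length_oddRatioProd_le (n : ℕ) : l (oddRatioProd c n) ≤ 5 * n * K := by
  match n with
  | 0 => simp [oddRatioProd, hl.one]
  | n + 1 =>
    rw [hc.oddRatioProd_succ]
    have e2 := hl.mul (ratio c 1 ^ (2 * n + 1)) (((ratio c 1 ^ 2)⁻¹ * ratio c 2) ^ n)
    have e3 := hl.mul (ratio c 1 ^ 2)⁻¹ (ratio c 2)
    have e4 := hl.inv (ratio c 1 ^ 2)
    have e5 := hl.pow_le hr1 (2 * n + 1)
    have e7 := hl.pow_le hr1 2
    have e6 := hl.pow_le (K := 3 * K) (a := (ratio c 1 ^ 2)⁻¹ * ratio c 2) (by linarith) n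
    linarith

-- Each doubling of the tree costs at most `5 * 2 ^ k * K`, and the geometric series sums to the
-- stated bound.
include hc hl hr1 hr2 in
theorem length_completeTree_le (k : ℕ) : l (completeTree c k) ≤ 5 * 2 ^ k * K := by
  induction k with
  | zero => simp [completeTree, hl.one]
  | succ k ih =>
    have e1 := hl.mul (oddRatioProd c (2 ^ k - 1)) (completeTree c k)
    have e2 := hc.length_oddRatioProd_le hl hr1 hr2 (2 ^ k - 1)
    have e3 : 5 * (2 ^ k - 1) * K ≤ 5 * 2 ^ k * K := by gcongr; exact Nat.sub_le _ _
    rw [completeTree, pow_succ]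
    linarith

include hc hl h1 hr1 hr2 in
theorem length_pow_le {n s : ℕ} (hs : s ≤ n) : l (c n ^ s) ≤ (3 * n + 3) * K := by
  match s with
  | 0 => simp [hl.one]
  | r + 1 =>
    -- The exponent `r + 1` is at most `n`, so the descent from level `n` ends at the positive level
    -- `m + 1`, as `pow_eq_mul_ratioProd` requires.
    obtain ⟨m, rfl⟩ : ∃ m, n = m + 1 + r := ⟨n - r - 1, by omega⟩
    rw [hc.pow_eq_mul_ratioProd (by omega)]
    have e1 := hl.mul (c (m + 1)) (ratioProd c r)⁻¹
    have e2 := hl.inv (ratioProd c r)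
    have e3 := hc.length_ratioProd_le hl hr1 hr2 r
    have e4 := hc.length_le hl h1 hr1 hr2 (m + 1)
    have e5 : 0 ≤ m * K := by positivity
    linarith

-- The constant is `5 + 3 + 5`: two conjugating tree elements and one power of the cycle.
include hc hl h1 hr1 hr2 in
theorem length_conj_le {k s : ℕ} (hs : s < 2 ^ k) :
    l ((completeTree c k)⁻¹ * c (2 ^ k - 1) ^ s * completeTree c k) ≤ 13 * K * 2 ^ k := by
  have e1 := hl.mul ((completeTree c k)⁻¹ * c (2 ^ k - 1) ^ s) (completeTree c k)
  have e2 := hl.mul (completeTree c k)⁻¹ (c (2 ^ k - 1) ^ s)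
  have e3 := hl.inv (completeTree c k)
  have e4 := hc.length_completeTree_le hl hr1 hr2 k
  have e5 := hc.length_pow_le hl h1 hr1 hr2 (n := 2 ^ k - 1) (s := s) (by omega)
  rw [show 3 * (2 ^ k - 1) + 3 = 3 * 2 ^ k by have := Nat.one_le_two_pow (n := k); omega] at e5
  linarith

end CyclicTower

end Tower

/-! ### Splitting maps between circles of integral length, lifted to the line -/

/-- The increasing function on the line that doubles the first unit interval of each period of
length `n + 1`. -/
def splitFun (n : ℕ) (x : ℝ) : ℝ :=
  x + ⌊x / (n + 1)⌋ + min 1 (x - (n + 1) * ⌊x / (n + 1)⌋)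

theorem splitFun_of_mem (n : ℕ) (q : ℤ) {y : ℝ} (h0 : 0 ≤ y) (h1 : y < n + 1) :
    splitFun n (y + (n + 1) * q) = min (2 * y) (y + 1) + (n + 2) * q := by
  have hn : (0 : ℝ) < n + 1 := by positivity
  have hfl : ⌊(y + (n + 1) * q) / (n + 1)⌋ = q := by
    rw [add_div, mul_div_cancel_left₀ _ hn.ne', Int.floor_add_intCast,
      Int.floor_eq_zero_iff.2 ⟨by positivity, (div_lt_one hn).2 h1⟩, zero_add]
  rw [splitFun, hfl, add_sub_cancel_right]
  rcases le_total y 1 with h | h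
  · rw [min_eq_right h, min_eq_left (by linarith)]; ring
  · rw [min_eq_left h, min_eq_right (by linarith)]; ring

theorem exists_eq_add_mul (n : ℕ) (x : ℝ) :
    ∃ (q : ℤ) (y : ℝ), 0 ≤ y ∧ y < n + 1 ∧ x = y + (n + 1) * q := by
  have hn : (0 : ℝ) < n + 1 := by positivity
  refine ⟨⌊x / (n + 1)⌋, x - (n + 1) * ⌊x / (n + 1)⌋, ?_, ?_, by ring⟩
  · have := (le_div_iff₀ hn).1 (Int.floor_le (x / (n + 1)))
    linarith
  · have := (div_lt_iff₀ hn).1 (Int.lt_floor_add_one (x / (n + 1)))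
    linarith

theorem splitFun_strictMono (n : ℕ) : StrictMono (splitFun n) := by
  intro x x' hxx
  obtain ⟨q, y, h0, h1, rfl⟩ := exists_eq_add_mul n x
  obtain ⟨q', y', h0', h1', rfl⟩ := exists_eq_add_mul n x'
  rw [splitFun_of_mem n q h0 h1, splitFun_of_mem n q' h0' h1']
  have hn : (0 : ℝ) < n + 1 := by positivity
  rcases lt_trichotomy q q' with h | h | h
  · have hq : (q : ℝ) + 1 ≤ q' := by exact_mod_cast h
    have h2 : ((n : ℝ) + 2) * (q + 1) ≤ (n + 2) * q' := by gcongr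
    have h3 := min_le_right (2 * y) (y + 1)
    have h4 : 0 ≤ min (2 * y') (y' + 1) := le_min (by linarith) (by linarith)
    linarith
  · subst h
    have : y < y' := by linarith
    have : min (2 * y) (y + 1) < min (2 * y') (y' + 1) := min_lt_min (by linarith) (by linarith)
    linarith
  · have hq : (q' : ℝ) + 1 ≤ q := by exact_mod_cast h
    have h2 : ((n : ℝ) + 1) * (q' + 1) ≤ (n + 1) * q := by gcongr
    linarith

theorem splitFun_surjective (n : ℕ) : Function.Surjective (splitFun n) := by
  intro x
  obtain ⟨q, y, h0, h1, rfl⟩ := exists_eq_add_mul (n + 1) x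
  push_cast at h1
  have hn : (0 : ℝ) ≤ n := by positivity
  rcases le_total y 2 with h | h
  · refine ⟨y / 2 + (n + 1) * q, ?_⟩
    rw [splitFun_of_mem n q (by linarith) (by linarith), min_eq_left (by linarith)]
    push_cast; ring
  · refine ⟨y - 1 + (n + 1) * q, ?_⟩
    rw [splitFun_of_mem n q (by linarith) (by linarith), min_eq_right (by linarith)]
    push_cast; ring

/-- The splitting map, as an automorphism of the ordered line. -/
def split (n : ℕ) : ℝ ≃o ℝ :=
  StrictMono.orderIsoOfSurjective (splitFun n) (splitFun_strictMono n) (splitFun_surjective n)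

/-- The translation of the line by `1`. -/
def unitShift : ℝ ≃o ℝ := OrderIso.addRight 1

theorem unitShift_apply (x : ℝ) : unitShift x = x + 1 := rfl

theorem unitShift_zpow_apply (k : ℤ) (x : ℝ) : (unitShift ^ k) x = x + k := by
  induction k using Int.induction_on generalizing x with
  | zero => simp
  | succ k ih => rw [zpow_add_one, RelIso.mul_apply, ih, unitShift_apply]; push_cast; ring
  | pred k ih =>
    have : (unitShift⁻¹) x = x - 1 := by
      apply unitShift.injective
      rw [RelIso.apply_inv_self, unitShift_apply, sub_add_cancel]
    rw [zpow_sub_one, RelIso.mul_apply, ih, this]; push_cast; ring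

theorem unitShift_pow_apply (k : ℕ) (x : ℝ) : (unitShift ^ k) x = x + k := by
  rw [← zpow_natCast, unitShift_zpow_apply]; simp

theorem unitShift_pow_inv_apply (k : ℕ) (x : ℝ) : ((unitShift ^ k)⁻¹) x = x - k := by
  rw [← zpow_natCast, ← zpow_neg, unitShift_zpow_apply]; push_cast; ring

theorem split_of_mem (n : ℕ) (q : ℤ) {y : ℝ} (h0 : 0 ≤ y) (h1 : y < n + 1) :
    split n (y + (n + 1) * q) = min (2 * y) (y + 1) + (n + 2) * q := splitFun_of_mem n q h0 h1

theorem split_add_mul (n : ℕ) (q : ℤ) (x : ℝ) :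
    split n (x + (n + 1) * q) = split n x + (n + 2) * q := by
  obtain ⟨p, y, h0, h1, rfl⟩ := exists_eq_add_mul n x
  rw [add_assoc, ← mul_add, ← Int.cast_add, split_of_mem n _ h0 h1, split_of_mem n _ h0 h1]
  push_cast; ring

theorem split_of_le_one (n : ℕ) {x : ℝ} (h0 : 0 ≤ x) (h1 : x ≤ 1) : split n x = 2 * x := by
  rcases lt_or_ge x (n + 1) with h | h
  · have := split_of_mem n 0 h0 h
    simp only [Int.cast_zero, mul_zero, add_zero] at this
    rw [this, min_eq_left (by linarith)]
  · have hn : (n : ℝ) = 0 := le_antisymm (by linarith) (by positivity)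
    have := split_of_mem n 1 (y := 0) le_rfl (by positivity)
    rw [hn] at this h
    have hx : x = 1 := by linarith
    rw [hx]
    simpa using this

theorem split_of_one_le (n : ℕ) {x : ℝ} (h0 : 1 ≤ x) (h1 : x ≤ n + 1) : split n x = x + 1 := by
  rcases lt_or_eq_of_le h1 with h | h
  · have := split_of_mem n 0 (by linarith) h
    simp only [Int.cast_zero, mul_zero, add_zero] at this
    rw [this, min_eq_right (by linarith)]
  · have := split_of_mem n 1 (y := 0) le_rfl (by positivity)
    rw [h]
    simp at this
    rw [this]; ring

theorem split_zero_apply (x : ℝ) : split 0 x = 2 * x := by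
  obtain ⟨q, y, h0, h1, rfl⟩ := exists_eq_add_mul 0 x
  simp only [Nat.cast_zero, zero_add] at h1
  rw [split_of_mem 0 _ h0 (by simpa using h1), min_eq_left (by linarith)]
  push_cast; ring

theorem split_zero_pow_apply (k : ℕ) (x : ℝ) : (split 0 ^ k) x = 2 ^ k * x := by
  induction k with
  | zero => simp
  | succ k ih => rw [pow_succ', RelIso.mul_apply, ih, split_zero_apply]; ring

theorem split_zero_pow_inv_apply (k : ℕ) (x : ℝ) : ((split 0 ^ k)⁻¹) x = x / 2 ^ k := by
  apply (split 0 ^ k).injective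
  rw [RelIso.apply_inv_self, split_zero_pow_apply]
  field_simp

theorem split_mul_unitShift_pow (n : ℕ) :
    split n * unitShift ^ (n + 1) = unitShift ^ (n + 2) * split n := by
  ext x
  rw [RelIso.mul_apply, RelIso.mul_apply, unitShift_pow_apply, unitShift_pow_apply]
  have := split_add_mul n 1 x
  push_cast at this ⊢
  rw [mul_one, mul_one] at this
  exact this

/-- Reduces identities between equivariant maps to one fundamental period. -/
theorem ext_of_period (n m : ℕ) {f g : ℝ → ℝ}
    (hf : ∀ x (q : ℤ), f (x + (n + 1) * q) = f x + m * q)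
    (hg : ∀ x (q : ℤ), g (x + (n + 1) * q) = g x + m * q)
    (h : ∀ x : ℝ, 0 ≤ x → x < n + 1 → f x = g x) (x : ℝ) : f x = g x := by
  obtain ⟨q, y, h0, h1, rfl⟩ := exists_eq_add_mul n x
  rw [hf, hg, h y h0 h1]

/-- Splittings of two distinct leaves commute; the bounds on `m` make the leaves distinct, and the
translations account for the relabelling caused by a new leaf. This is the source of the shift
relation. -/
theorem split_comm {n m : ℕ} (h1 : 1 ≤ m) (hmn : m ≤ n) :
    split (n + 1) * (unitShift ^ (m + 1))⁻¹ * split n * unitShift ^ m =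
      (unitShift ^ (m + 1))⁻¹ * split (n + 1) * unitShift ^ m * split n := by
  have h1' : (1 : ℝ) ≤ m := by exact_mod_cast h1
  have hmn' : (m : ℝ) ≤ n := by exact_mod_cast hmn
  ext x
  simp only [RelIso.mul_apply, unitShift_pow_apply, unitShift_pow_inv_apply]
  have hs (x : ℝ) (q : ℤ) : split (n + 1) (x + (n + 2) * q) = split (n + 1) x + (n + 3) * q := by
    have := split_add_mul (n + 1) q x
    push_cast at this
    rw [show (n : ℝ) + 2 = n + 1 + 1 by ring, this]; ring
  refine ext_of_period n (n + 3) (f := fun x => split (n + 1) (split n (x + m) - (m + 1 : ℕ)))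
    (g := fun x => split (n + 1) (split n x + m) - (m + 1 : ℕ)) ?_ ?_ ?_ x
  · intro x q
    rw [add_right_comm, split_add_mul, add_sub_right_comm, hs]
    push_cast; ring
  · intro x q
    rw [split_add_mul, add_right_comm, hs]
    push_cast; ring
  · intro x h0 hx
    push_cast
    rcases le_total (x + m) (n + 1) with h | h
    · rw [split_of_one_le n (by linarith) h, show x + m + 1 - (m + 1) = x by ring]
      rcases le_total x 1 with hx1 | hx1
      · rw [split_of_le_one _ h0 hx1, split_of_le_one _ h0 hx1,
          split_of_one_le _ (by linarith) (by push_cast; linarith)]; ring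
      · rw [split_of_one_le _ hx1 (by push_cast; linarith), split_of_one_le _ hx1 hx.le,
          split_of_one_le _ (by linarith) (by push_cast; linarith)]; ring
    -- Here `x` lies in the part that the translation by `m` carries past the end of the period; `u`
    -- is its position in the next period.
    · obtain ⟨u, rfl⟩ : ∃ u, x = u - m + (n + 1) := ⟨x + m - (n + 1), by ring⟩
      have e1 := split_add_mul n 1 u
      have e2 := hs u 1
      push_cast at e1 e2
      rw [mul_one, mul_one] at e1 e2
      rw [split_of_one_le n (x := u - m + (n + 1)) (by linarith) hx.le,
        show u - m + ((n : ℝ) + 1) + 1 + m = u + (n + 2) by ring, e2,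
        show u - m + ((n : ℝ) + 1) + m = u + (n + 1) by ring, e1]
      rcases le_total u 1 with hu | hu
      · rw [split_of_le_one _ (by linarith) hu, split_of_le_one _ (by linarith) hu,
          split_of_one_le _ (by linarith) (by push_cast; linarith)]; ring
      · rw [split_of_one_le n hu (by linarith), split_of_one_le _ hu (by push_cast; linarith),
          split_of_one_le _ (by linarith) (by push_cast; linarith)]; ring

/-- `split 0` is multiplication by `2`, that is, halving of every leaf. Splitting one leaf before
halving all leaves equals halving first and then splitting both halves, the second of which has
moved to position `2`. -/
theorem split_zero_mul_split (n : ℕ) :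
    split 0 * split n =
      unitShift ^ 2 * split (2 * n + 2) * (unitShift ^ 2)⁻¹ * split (2 * n + 1) * split 0 := by
  ext x
  simp only [RelIso.mul_apply, unitShift_pow_apply, unitShift_pow_inv_apply, split_zero_apply]
  refine ext_of_period n (2 * n + 4) (f := fun x => 2 * split n x)
    (g := fun x => split (2 * n + 2) (split (2 * n + 1) (2 * x) - (2 : ℕ)) + (2 : ℕ)) ?_ ?_ ?_ x
  · intro x q
    rw [split_add_mul]; push_cast; ring
  · intro x q
    have e1 := split_add_mul (2 * n + 1) q (2 * x)
    have e2 := split_add_mul (2 * n + 2) q (split (2 * n + 1) (2 * x) - 2)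
    push_cast at e1 e2 ⊢
    rw [show 2 * (x + ((n : ℝ) + 1) * q) = 2 * x + (2 * n + 1 + 1) * q by ring, e1,
      show ∀ z : ℝ, z + (2 * (n : ℝ) + 1 + 2) * q - 2 = z - 2 + (2 * n + 2 + 1) * q by intro z; ring,
      e2]
    ring
  · intro x h0 hx
    push_cast
    rcases le_total (2 * x) 1 with h | h
    · rw [split_of_le_one _ h0 (by linarith), split_of_le_one _ (by linarith) h]
      have e2 := split_add_mul (2 * n + 2) (-1) (2 * (2 * x) - 2 + (2 * n + 3))
      push_cast at e2
      rw [show 2 * (2 * x) - 2 = 2 * (2 * x) - 2 + (2 * n + 3) + (2 * n + 2 + 1) * (-1 : ℝ) by ring,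
        e2, split_of_one_le _ (by linarith) (by push_cast; linarith)]
      ring
    · rw [split_of_one_le _ h (by push_cast; linarith)]
      rcases le_total x 1 with hx1 | hx1
      · rw [split_of_le_one _ h0 hx1, split_of_le_one _ (by linarith) (by linarith)]; ring
      · rw [split_of_one_le _ hx1 hx.le,
          split_of_one_le _ (by linarith) (by push_cast; linarith)]; ring

/-! ### Left vines and the tower of their rotations -/

/-- The map from the circle of length `1` to the circle of length `n + 1` given by the left vine
with `n + 1` leaves. -/
def vine : ℕ → ℝ ≃o ℝ
  | 0 => 1
  | n + 1 => split n * vine n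

/-- The element that rotates the leaves of the left vine with `n + 1` leaves. -/
def vineRot (n : ℕ) : ℝ ≃o ℝ := (vine n)⁻¹ * unitShift * vine n

theorem vineRot_pow (n k : ℕ) : vineRot n ^ k = (vine n)⁻¹ * unitShift ^ k * vine n := by
  have := conj_pow (i := k) (a := (vine n)⁻¹) (b := unitShift)
  rw [inv_inv] at this
  exact this

theorem vineRot_zpow (n : ℕ) (k : ℤ) : vineRot n ^ k = (vine n)⁻¹ * unitShift ^ k * vine n := by
  have := conj_zpow (i := k) (a := (vine n)⁻¹) (b := unitShift)
  rw [inv_inv] at this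
  exact this

theorem vine_conj (n : ℕ) : (vine n)⁻¹ * unitShift ^ (n + 1) * vine n = unitShift := by
  induction n with
  | zero => simp [vine]
  | succ n ih =>
    rw [vine, mul_inv_rev]
    calc _ = (vine n)⁻¹ * (split n)⁻¹ * (unitShift ^ (n + 2) * split n) * vine n := by group
      _ = _ := by rw [← split_mul_unitShift_pow, ← mul_assoc, inv_mul_cancel_right, ih]

theorem cyclicTower_vineRot : CyclicTower vineRot where
  pow_succ_eq n := by rw [vineRot_pow, vine_conj]; simp [vineRot, vine]
  shift n j hj hn := by
    have h := split_comm hj hn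
    simp only [vineRot_pow, vine]
    have h' : (unitShift ^ (j + 1))⁻¹ * split (n + 1) * unitShift ^ j =
      split (n + 1) * (unitShift ^ (j + 1))⁻¹ * split n * unitShift ^ j * (split n)⁻¹ := by
      rw [h, mul_inv_cancel_right]
    calc _ = (vine n)⁻¹ * (split n)⁻¹ * (split (n + 1))⁻¹ *
          ((unitShift ^ (j + 1))⁻¹ * split (n + 1) * unitShift ^ j) * split n * vine n := by group
      _ = _ := by rw [h']; group

/-- The abstract product is identified with the change from the left vine with `n + 1` leaves, all
halved, to the left vine with `2 * n + 2` leaves. -/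
theorem oddRatioProd_vineRot (n : ℕ) :
    oddRatioProd vineRot n = (vine (2 * n + 1))⁻¹ * split 0 * vine n := by
  induction n with
  | zero => simp [oddRatioProd, vine]
  | succ n ih =>
    rw [oddRatioProd, ih, ← cyclicTower_vineRot.sq_mul_inv_sq (by omega),
      show 2 * n + 1 + 2 = 2 * n + 3 by ring, show 2 * (n + 1) + 1 = 2 * n + 3 by ring,
      show 2 * n + 1 + 1 = 2 * n + 2 by ring, vineRot_pow, vineRot_pow]
    have h := split_zero_mul_split n
    calc _ = (vine (2 * n + 3))⁻¹ * unitShift ^ 2 * (split (2 * n + 2) * vine (2 * n + 2)) *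
          (vine (2 * n + 2))⁻¹ * (unitShift ^ 2)⁻¹ * (split (2 * n + 1) * vine (2 * n + 1)) *
          (vine (2 * n + 1))⁻¹ * split 0 * vine n := by
            simp only [vine]; group
      _ = (vine (2 * n + 3))⁻¹ * (unitShift ^ 2 * split (2 * n + 2) * (unitShift ^ 2)⁻¹ *
          split (2 * n + 1) * split 0) * vine n := by group
      _ = _ := by rw [← h, ← mul_assoc, mul_assoc _ (split n), ← vine]

theorem completeTree_vineRot (k : ℕ) :
    completeTree vineRot k = (vine (2 ^ k - 1))⁻¹ * split 0 ^ k := by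
  induction k with
  | zero => simp [completeTree, vine]
  | succ k ih =>
    have : 2 * (2 ^ k - 1) + 1 = 2 ^ (k + 1) - 1 := by
      have := Nat.one_le_two_pow (n := k)
      rw [pow_succ]; omega
    rw [completeTree, ih, oddRatioProd_vineRot, this, pow_succ']
    group

/-- The vine cancels in the conjugation, leaving translation by `s` conjugated by multiplication by
`2 ^ k`. -/
theorem completeTree_conj_apply (k s : ℕ) (x : ℝ) :
    ((completeTree vineRot k)⁻¹ * vineRot (2 ^ k - 1) ^ s * completeTree vineRot k) x =
      x + s / 2 ^ k := by
  have : (completeTree vineRot k)⁻¹ * vineRot (2 ^ k - 1) ^ s * completeTree vineRot k =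
      (split 0 ^ k)⁻¹ * unitShift ^ s * split 0 ^ k := by
    rw [completeTree_vineRot, vineRot_pow]; group
  rw [this, RelIso.mul_apply, RelIso.mul_apply, split_zero_pow_apply, unitShift_pow_apply,
    split_zero_pow_inv_apply]
  field_simp

/-! ### Lifts of elements of `T` to the line -/

theorem coe_eq_coe_iff {x y : ℝ} : (x : UnitAddCircle) = y ↔ ∃ n : ℤ, x = y + n := by
  rw [← sub_eq_zero, ← AddCircle.coe_sub, AddCircle.coe_eq_zero_iff]
  refine exists_congr fun n => ?_
  rw [zsmul_one, eq_sub_iff_add_eq, add_comm, eq_comm]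

theorem coe_add_intCast (x : ℝ) (n : ℤ) : ((x + n : ℝ) : UnitAddCircle) = x :=
  coe_eq_coe_iff.2 ⟨n, rfl⟩

/-- A real number that is a dyadic rational. -/
def IsDyadicReal (x : ℝ) : Prop := ∃ (a : ℤ) (n : ℕ), x = a / 2 ^ n

theorem isDyadicReal_iff {x : ℝ} : IsDyadicReal x ↔ ∃ q : dyadicRationals, x = ((q : ℚ) : ℝ) := by
  constructor
  · rintro ⟨a, n, rfl⟩
    exact ⟨⟨a / 2 ^ n, a, n, rfl⟩, by push_cast; rfl⟩
  · rintro ⟨⟨_, a, n, rfl⟩, rfl⟩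
    exact ⟨a, n, by push_cast; rfl⟩

theorem IsDyadicReal.add {x y : ℝ} (hx : IsDyadicReal x) (hy : IsDyadicReal y) :
    IsDyadicReal (x + y) := by
  rw [isDyadicReal_iff] at *
  obtain ⟨p, rfl⟩ := hx
  obtain ⟨q, rfl⟩ := hy
  exact ⟨p + q, by push_cast; rfl⟩

theorem isDyadicReal_intCast (n : ℤ) : IsDyadicReal n := ⟨n, 0, by simp⟩

theorem isDyadicReal_add_intCast {x : ℝ} (n : ℤ) : IsDyadicReal (x + n) ↔ IsDyadicReal x := by
  refine ⟨fun h => ?_, fun h => h.add (isDyadicReal_intCast n)⟩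
  have := h.add (isDyadicReal_intCast (-n))
  push_cast at this
  rwa [add_neg_cancel_right] at this

theorem isDyadicReal_two_mul {x : ℝ} : IsDyadicReal (2 * x) ↔ IsDyadicReal x := by
  constructor
  · rintro ⟨a, n, h⟩
    refine ⟨a, n + 1, ?_⟩
    rw [pow_succ, ← div_div, ← h]; ring
  · intro h
    rw [two_mul]
    exact h.add h

theorem isDyadicPoint_coe {x : ℝ} : IsDyadicPoint (x : UnitAddCircle) ↔ IsDyadicReal x := by
  constructor
  · rintro ⟨q, hq⟩
    obtain ⟨n, rfl⟩ := coe_eq_coe_iff.1 hq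
    exact (isDyadicReal_add_intCast n).2 (isDyadicReal_iff.2 ⟨q, rfl⟩)
  · intro h
    obtain ⟨q, rfl⟩ := isDyadicReal_iff.1 h
    exact ⟨q, rfl⟩

/-- Near the real number `x`, the map `f` is affine with slope an integral power of `2`. -/
def IsAffineAt (f : ℝ → ℝ) (x : ℝ) : Prop :=
  ∃ k : ℤ, ∀ᶠ t : ℝ in 𝓝 0, f (x + t) = f x + 2 ^ k * t

/-- The group of the piecewise linear automorphisms of the line that preserve the dyadic numbers,
with dyadic break points and slopes integral powers of `2`. -/
def dyadicPL : Subgroup (ℝ ≃o ℝ) where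
  carrier := {f | (∀ x, IsDyadicReal (f x) ↔ IsDyadicReal x) ∧
    ∃ B : Set ℝ, (∀ a b, (B ∩ Set.Icc a b).Finite) ∧ (∀ b ∈ B, IsDyadicReal b) ∧
      ∀ x ∉ B, IsAffineAt f x}
  one_mem' := ⟨fun _ => Iff.rfl, ∅, by simp, by simp, fun x _ => ⟨0, by simp⟩⟩
  mul_mem' := by
    rintro f g ⟨hf, A, hA, hA', hfA⟩ ⟨hg, B, hB, hB', hgB⟩
    refine ⟨fun x => (hf (g x)).trans (hg x), B ∪ g ⁻¹' A, fun a b => ?_, ?_, ?_⟩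
    · rw [Set.union_inter_distrib_right]
      refine (hB a b).union (((hA (g a) (g b)).preimage g.injective.injOn).subset ?_)
      rintro x ⟨hx, h1, h2⟩
      exact ⟨hx, g.monotone h1, g.monotone h2⟩
    · rintro b (hb | hb)
      · exact hB' b hb
      · exact (hg b).1 (hA' _ hb)
    · intro x hx
      obtain ⟨k, hk⟩ := hgB x (fun h => hx (Or.inl h))
      obtain ⟨l, hl⟩ := hfA (g x) (fun h => hx (Or.inr h))
      refine ⟨l + k, ?_⟩
      have ht : Tendsto (fun t : ℝ => (2 : ℝ) ^ k * t) (𝓝 0) (𝓝 0) := by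
        have : Continuous (fun t : ℝ => (2 : ℝ) ^ k * t) := by fun_prop
        simpa using this.tendsto 0
      filter_upwards [hk, ht.eventually hl] with t h1 h2
      rw [RelIso.mul_apply, RelIso.mul_apply, h1, h2, zpow_add₀ (by norm_num), mul_assoc]
  inv_mem' := by
    rintro f ⟨hf, A, hA, hA', hfA⟩
    refine ⟨fun x => ?_, f '' A, fun a b => ?_, ?_, ?_⟩
    · rw [← hf, RelIso.apply_inv_self]
    · refine ((hA (f⁻¹ a) (f⁻¹ b)).image f).subset ?_
      rintro _ ⟨⟨x, hx, rfl⟩, h1, h2⟩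
      refine ⟨x, ⟨hx, ?_, ?_⟩, rfl⟩
      · rwa [← f.le_iff_le, RelIso.apply_inv_self]
      · rwa [← f.le_iff_le, RelIso.apply_inv_self]
    · rintro _ ⟨a, ha, rfl⟩
      exact (hf a).2 (hA' a ha)
    · intro y hy
      obtain ⟨k, hk⟩ := hfA (f⁻¹ y) (fun h => hy ⟨_, h, RelIso.apply_inv_self f y⟩)
      refine ⟨-k, ?_⟩
      have ht : Tendsto (fun t : ℝ => (2 : ℝ) ^ (-k) * t) (𝓝 0) (𝓝 0) := by
        have : Continuous (fun t : ℝ => (2 : ℝ) ^ (-k) * t) := by fun_prop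
        simpa using this.tendsto 0
      filter_upwards [ht.eventually hk] with t h1
      apply f.injective
      rw [RelIso.apply_inv_self, h1, RelIso.apply_inv_self, ← mul_assoc,
        ← zpow_add₀ (by norm_num)]
      simp

theorem unitShift_mem : unitShift ∈ dyadicPL := by
  refine ⟨fun x => ?_, ∅, by simp, by simp, fun x _ => ⟨0, ?_⟩⟩
  · simpa [unitShift_apply] using isDyadicReal_add_intCast (x := x) 1
  · exact Eventually.of_forall fun t => by simp [unitShift_apply]; ring

theorem isAffineAt_of_eventuallyEq {f g : ℝ → ℝ} {x : ℝ} (h : f =ᶠ[𝓝 x] g)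
    (hg : IsAffineAt g x) : IsAffineAt f x := by
  obtain ⟨k, hk⟩ := hg
  have ht : Tendsto (fun t : ℝ => x + t) (𝓝 0) (𝓝 x) := by
    have : Continuous (fun t : ℝ => x + t) := by fun_prop
    simpa using this.tendsto 0
  refine ⟨k, ?_⟩
  filter_upwards [hk, ht.eventually h] with t h1 h2
  rw [h2, h1, h.eq_of_nhds]

theorem split_mem (n : ℕ) : split n ∈ dyadicPL := by
  refine ⟨fun x => ?_, Set.range ((↑) : ℤ → ℝ), fun a b => ?_, ?_, fun x hx => ?_⟩
  · obtain ⟨q, y, h0, h1, rfl⟩ := exists_eq_add_mul n x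
    rw [split_of_mem n q h0 h1, show y + ((n : ℝ) + 1) * q = y + (((n + 1) * q : ℤ) : ℝ) by simp,
      show ∀ z : ℝ, z + ((n : ℝ) + 2) * q = z + (((n + 2) * q : ℤ) : ℝ) by simp,
      isDyadicReal_add_intCast, isDyadicReal_add_intCast]
    rcases min_choice (2 * y) (y + 1) with h | h <;> rw [h]
    · exact isDyadicReal_two_mul
    · simpa using isDyadicReal_add_intCast (x := y) 1
  · refine ((Set.finite_Icc ⌈a⌉ ⌊b⌋).image ((↑) : ℤ → ℝ)).subset ?_
    rintro _ ⟨⟨m, rfl⟩, h1, h2⟩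
    exact ⟨m, ⟨Int.ceil_le.2 h1, Int.le_floor.2 h2⟩, rfl⟩
  · rintro _ ⟨m, rfl⟩
    exact isDyadicReal_intCast m
  · obtain ⟨q, y, h0, h1, rfl⟩ := exists_eq_add_mul n x
    have hy (m : ℤ) : y ≠ m := fun h => hx ⟨m + (n + 1) * q, by rw [h]; push_cast; ring⟩
    have hy0 : 0 < y := lt_of_le_of_ne h0 fun h => hy 0 (by simp [← h])
    have hc : Tendsto (fun z : ℝ => z - (n + 1) * q) (𝓝 (y + (n + 1) * q)) (𝓝 y) := by
      have : Continuous (fun z : ℝ => z - (n + 1) * q) := by fun_prop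
      simpa using this.tendsto (y + (n + 1) * q)
    have key : ∀ᶠ z in 𝓝 (y + (n + 1) * q), split n z =
        min (2 * (z - (n + 1) * q)) (z - (n + 1) * q + 1) + (n + 2) * q := by
      filter_upwards [hc.eventually (lt_mem_nhds hy0), hc.eventually (gt_mem_nhds h1)] with z h2 h3
      have := split_of_mem n q h2.le h3
      rwa [sub_add_cancel] at this
    rcases lt_or_gt_of_ne (show y ≠ 1 by simpa using hy 1) with h | h
    · refine isAffineAt_of_eventuallyEq
        (g := fun z => 2 * (z - (n + 1) * q) + (n + 2) * q) ?_
        ⟨1, Eventually.of_forall fun t => by simp only [zpow_one]; ring⟩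
      filter_upwards [key, hc.eventually (gt_mem_nhds h)] with z h2 h3
      rw [h2, min_eq_left (by linarith)]
    · refine isAffineAt_of_eventuallyEq
        (g := fun z => z - (n + 1) * q + 1 + (n + 2) * q) ?_
        ⟨0, Eventually.of_forall fun t => by simp only [zpow_zero]; ring⟩
      filter_upwards [key, hc.eventually (lt_mem_nhds h)] with z h2 h3
      rw [h2, min_eq_right (by linarith)]

theorem vine_mem (n : ℕ) : vine n ∈ dyadicPL := by
  induction n with
  | zero => exact one_mem _
  | succ n ih => exact mul_mem (split_mem n) ih

/-- The group of the lifts to the line of the elements of `T`. -/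
def liftGroup : Subgroup (ℝ ≃o ℝ) := dyadicPL ⊓ Subgroup.centralizer {unitShift}

theorem vineRot_mem (n : ℕ) : vineRot n ∈ liftGroup := by
  refine Subgroup.mem_inf.2
    ⟨mul_mem (mul_mem (inv_mem (vine_mem n)) unitShift_mem) (vine_mem n), ?_⟩
  rw [Subgroup.mem_centralizer_singleton_iff]
  have := cyclicTower_vineRot.commute_zero n
  have h0 : vineRot 0 = unitShift := by simp [vineRot, vine]
  rw [h0] at this
  exact this.eq.symm

theorem lift_add_intCast (f : liftGroup) (x : ℝ) (n : ℤ) : f.1 (x + n) = f.1 x + n := by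
  have h : f.1 * unitShift = unitShift * f.1 :=
    Subgroup.mem_centralizer_singleton_iff.1 f.2.2
  have h' : Commute f.1 (unitShift ^ n) := Commute.zpow_right h n
  have := congrArg (fun e : ℝ ≃o ℝ => e x) h'.eq
  simpa [RelIso.mul_apply, unitShift_zpow_apply] using this

/-- The map of the circle induced by a lift. -/
def circleMap (f : liftGroup) : UnitAddCircle → UnitAddCircle :=
  Function.Periodic.lift (f := fun x : ℝ => (f.1 x : UnitAddCircle)) (c := 1) fun x => by
    have := lift_add_intCast f x 1
    rw [Int.cast_one] at this
    simp only [this]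
    simp

theorem circleMap_coe (f : liftGroup) (x : ℝ) : circleMap f x = (f.1 x : UnitAddCircle) := rfl

theorem continuous_circleMap (f : liftGroup) : Continuous (circleMap f) := by
  refine (QuotientAddGroup.isQuotientMap_mk _).continuous_iff.2 ?_
  exact (AddCircle.continuous_mk' 1).comp f.1.continuous

/-- The homeomorphism of the circle induced by a lift. -/
def circleHomeo (f : liftGroup) : UnitAddCircle ≃ₜ UnitAddCircle where
  toFun := circleMap f
  invFun := circleMap f⁻¹
  left_inv x := by
    induction x using QuotientAddGroup.induction_on with
    | H x =>
      rw [circleMap_coe, circleMap_coe, InvMemClass.coe_inv, RelIso.inv_apply_self]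
  right_inv x := by
    induction x using QuotientAddGroup.induction_on with
    | H x =>
      rw [circleMap_coe, circleMap_coe, InvMemClass.coe_inv, RelIso.apply_inv_self]
  continuous_toFun := continuous_circleMap f
  continuous_invFun := continuous_circleMap f⁻¹

theorem circleHomeo_coe (f : liftGroup) (x : ℝ) : circleHomeo f x = (f.1 x : UnitAddCircle) := rfl

theorem circleHomeo_mem (f : liftGroup) : circleHomeo f ∈ T := by
  obtain ⟨hd, B, hB, hB', hfB⟩ := f.2.1
  refine ⟨fun x => ?_, (↑) '' (B ∩ Set.Icc 0 1), (hB 0 1).image _, ?_, fun x hx => ?_⟩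
  · induction x using QuotientAddGroup.induction_on with
    | H x => exact isDyadicPoint_coe.trans ((hd x).trans isDyadicPoint_coe.symm)
  · rintro _ ⟨b, hb, rfl⟩
    exact isDyadicPoint_coe.2 (hB' b hb.1)
  · induction x using QuotientAddGroup.induction_on with
    | H x =>
      have hfr : ((Int.fract x : ℝ) : UnitAddCircle) = x :=
        coe_eq_coe_iff.2 ⟨-⌊x⌋, by rw [← Int.self_sub_floor]; push_cast; ring⟩
      have hx' : ((Int.fract x : ℝ) : UnitAddCircle) ∉ (↑) '' (B ∩ Set.Icc 0 1) := by
        rw [hfr]; exact hx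
      obtain ⟨k, hk⟩ := hfB (Int.fract x) fun h => hx' ⟨_, ⟨h, Int.fract_nonneg x,
        (Int.fract_lt_one x).le⟩, rfl⟩
      refine ⟨k, ?_⟩
      filter_upwards [hk] with t ht
      change circleHomeo f ((x : UnitAddCircle) + _) = circleHomeo f (x : UnitAddCircle) + _
      rw [← hfr, ← AddCircle.coe_add, circleHomeo_coe, circleHomeo_coe, ht, AddCircle.coe_add]

/-- The projection from the group of lifts to `T`. -/
def proj : liftGroup →* T :=
  MonoidHom.mk' (fun f => ⟨circleHomeo f, circleHomeo_mem f⟩) fun f g => by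
    ext x
    induction x using QuotientAddGroup.induction_on with
    | H x => rfl

theorem proj_coe (f : liftGroup) (x : ℝ) : (proj f).1 x = (f.1 x : UnitAddCircle) := rfl

/-- The rotation of the leaves of the left vine, as a lift of an element of `T`. -/
def liftRot (n : ℕ) : liftGroup := ⟨vineRot n, vineRot_mem n⟩

theorem cyclicTower_liftRot : CyclicTower liftRot where
  pow_succ_eq n := Subtype.ext (cyclicTower_vineRot.pow_succ_eq n)
  shift n j hj hn := Subtype.ext (cyclicTower_vineRot.shift n j hj hn)

theorem coe_oddRatioProd_liftRot (n : ℕ) :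
    ((oddRatioProd liftRot n : liftGroup) : ℝ ≃o ℝ) = oddRatioProd vineRot n := by
  induction n with
  | zero => rfl
  | succ n ih => rw [oddRatioProd, oddRatioProd, ← ih]; rfl

theorem coe_completeTree_liftRot (k : ℕ) :
    ((completeTree liftRot k : liftGroup) : ℝ ≃o ℝ) = completeTree vineRot k := by
  induction k with
  | zero => rfl
  | succ k ih => rw [completeTree, completeTree, ← ih, ← coe_oddRatioProd_liftRot]; rfl

theorem completeTree_mem_closure (k : ℕ) :
    completeTree liftRot k ∈ Subgroup.closure (Set.range liftRot) := by
  have hm (n : ℕ) : liftRot n ∈ Subgroup.closure (Set.range liftRot) :=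
    Subgroup.subset_closure ⟨n, rfl⟩
  have hW (n : ℕ) : oddRatioProd liftRot n ∈ Subgroup.closure (Set.range liftRot) := by
    induction n with
    | zero => exact one_mem _
    | succ n ih => exact mul_mem (mul_mem (hm _) (inv_mem (hm _))) ih
  induction k with
  | zero => exact one_mem _
  | succ k ih => exact mul_mem (hW _) ih

/-! ### Elements of `T` are affine on a dyadic subdivision -/

/-- For small `s > 0` the two representatives differ by less than `1`, so equality on the circle is
equality of real numbers. -/
theorem zpow_eq_of_eventually {k l : ℤ}
    (h : ∀ᶠ s : ℝ in 𝓝 0, (((2 : ℝ) ^ k * s : ℝ) : UnitAddCircle) = (((2 : ℝ) ^ l * s : ℝ))) :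
    k = l := by
  have hc : Tendsto (fun s : ℝ => |(2 : ℝ) ^ k * s - (2 : ℝ) ^ l * s|) (𝓝 0) (𝓝 0) := by
    have : Continuous (fun s : ℝ => |(2 : ℝ) ^ k * s - (2 : ℝ) ^ l * s|) := by fun_prop
    simpa using this.tendsto 0
  have h1 := h.and (hc.eventually (gt_mem_nhds one_pos))
  obtain ⟨s, ⟨h2, h3⟩, h0⟩ :=
    ((h1.filter_mono (nhdsWithin_le_nhds (s := Set.Ioi 0))).and self_mem_nhdsWithin).exists
  obtain ⟨n, hn⟩ := coe_eq_coe_iff.1 h2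
  have h4 : |(n : ℝ)| < 1 := by rwa [hn, add_sub_cancel_left] at h3
  have h5 : n = 0 := Int.abs_lt_one_iff.1 (by exact_mod_cast h4)
  rw [h5, Int.cast_zero, add_zero] at hn
  exact zpow_right_injective₀ (by norm_num) (by norm_num) (mul_right_cancel₀ (ne_of_gt h0) hn)

/-- The points near which `f` agrees with one fixed affine map form an open and relatively closed
subset of the connected open interval; continuity adds the end points. -/
theorem affine_of_locally_affine {f : ℝ → UnitAddCircle} (hf : Continuous f) {u v : ℝ} (huv : u < v)
    (h : ∀ t ∈ Set.Ioo u v, ∃ k : ℤ, ∀ᶠ s : ℝ in 𝓝 0, f (t + s) = f t + ((2 : ℝ) ^ k * s : ℝ)) :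
    ∃ k : ℤ, ∀ t ∈ Set.Icc u v, f t = f u + ((2 : ℝ) ^ k * (t - u) : ℝ) := by
  have h' : ∀ t ∈ Set.Ioo u v, ∃ k : ℤ, ∀ᶠ w in 𝓝 t, f w = f t + ((2 : ℝ) ^ k * (w - t) : ℝ) := by
    intro t ht
    obtain ⟨k, hk⟩ := h t ht
    have hc : Tendsto (fun w : ℝ => w - t) (𝓝 t) (𝓝 0) := by
      have : Continuous (fun w : ℝ => w - t) := by fun_prop
      simpa using this.tendsto t
    refine ⟨k, ?_⟩
    filter_upwards [hc.eventually hk] with w hw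
    rwa [add_sub_cancel] at hw
  obtain ⟨t₀, ht₀⟩ : (Set.Ioo u v).Nonempty := Set.nonempty_Ioo.2 huv
  obtain ⟨k, hk⟩ := h' t₀ ht₀
  set g : ℝ → UnitAddCircle := fun w => f t₀ + ((2 : ℝ) ^ k * (w - t₀) : ℝ) with hg
  have hsub : Set.Ioo u v ⊆ {t | ∀ᶠ w in 𝓝 t, f w = g w} := by
    refine isPreconnected_Ioo.subset_of_closure_inter_subset isOpen_setOfPred_eventually_nhds
      ⟨t₀, ht₀, hk⟩ ?_
    rintro t ⟨ht, htI⟩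
    obtain ⟨l, hl⟩ := h' t htI
    obtain ⟨t', h1, h2⟩ :=
      ((mem_closure_iff_frequently.1 ht).and_eventually (eventually_eventually_nhds.2 hl)).exists
    have e : f t + (((2 : ℝ) ^ l * (t' - t) : ℝ) : UnitAddCircle) = g t' :=
      h2.self_of_nhds.symm.trans h1.self_of_nhds
    have hlk : l = k := by
      apply zpow_eq_of_eventually
      have hc : Tendsto (fun s : ℝ => t' + s) (𝓝 0) (𝓝 t') := by
        have : Continuous (fun s : ℝ => t' + s) := by fun_prop
        simpa using this.tendsto 0
      filter_upwards [hc.eventually h1, hc.eventually h2] with s h3 h4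
      have e' := h4.symm.trans h3
      rw [hg] at e e'
      simp only at e e'
      rw [show (2 : ℝ) ^ l * (t' + s - t) = 2 ^ l * (t' - t) + 2 ^ l * s by ring,
        show (2 : ℝ) ^ k * (t' + s - t₀) = 2 ^ k * (t' - t₀) + 2 ^ k * s by ring,
        AddCircle.coe_add, AddCircle.coe_add, ← add_assoc, ← add_assoc, e] at e'
      exact add_left_cancel e'
    subst hlk
    filter_upwards [hl] with w hw
    rw [hw, hg]
    simp only
    rw [show (2 : ℝ) ^ l * (w - t) = 2 ^ l * (t' - t) + 2 ^ l * (w - t') by ring,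
      AddCircle.coe_add, ← add_assoc, e, hg]
    simp only
    rw [add_assoc, ← AddCircle.coe_add]
    congr 2
    ring
  have hgc : Continuous g := by
    have : Continuous fun w : ℝ => (2 : ℝ) ^ k * (w - t₀) := by fun_prop
    exact continuous_const.add ((AddCircle.continuous_mk' 1).comp this)
  have heq : Set.EqOn f g (Set.Icc u v) := by
    rw [← closure_Ioo huv.ne]
    exact Set.EqOn.closure (fun t ht => (hsub ht).self_of_nhds) hf hgc
  refine ⟨k, fun t ht => ?_⟩
  rw [heq ht, heq (Set.left_mem_Icc.2 huv.le)]
  simp only [hg]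
  rw [add_assoc, ← AddCircle.coe_add]
  congr 2
  ring

theorem coe_div_two_pow_of_le {N n : ℕ} (h : n ≤ N) (a : ℤ) :
    (a / 2 ^ n : ℝ) = ((a * 2 ^ (N - n) : ℤ) : ℝ) / 2 ^ N := by
  obtain ⟨d, rfl⟩ := Nat.exists_eq_add_of_le h
  rw [Nat.add_sub_cancel_left, pow_add]
  push_cast
  field_simp

theorem exists_common_exponent {X : Type*} {B : Set X} (hB : B.Finite) (n : X → ℕ) :
    ∃ N, ∀ b ∈ B, n b ≤ N := by
  obtain ⟨N, hN⟩ := (hB.image n).bddAbove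
  exact ⟨N, fun b hb => hN ⟨b, hb, rfl⟩⟩

theorem isDyadicPoint_iff {x : UnitAddCircle} :
    IsDyadicPoint x ↔ ∃ (a : ℤ) (n : ℕ), x = ((a / 2 ^ n : ℝ) : UnitAddCircle) := by
  constructor
  · rintro ⟨q, rfl⟩
    obtain ⟨a, n, h⟩ := isDyadicReal_iff.2 ⟨q, rfl⟩
    exact ⟨a, n, by rw [← h]; rfl⟩
  · rintro ⟨a, n, rfl⟩
    exact isDyadicPoint_coe.2 ⟨a, n, rfl⟩

/-- With `N` at least every exponent of a break point, break points occur only at ends of arcs of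
depth `N`. -/
theorem exists_affine (g : T) : ∃ N : ℕ, ∀ a : ℤ, ∃ k : ℤ, ∀ t : ℝ, 0 ≤ t → t ≤ 1 →
    g.1 (((a + t) / 2 ^ N : ℝ)) = g.1 ((a / 2 ^ N : ℝ)) + ((2 : ℝ) ^ k * t : ℝ) := by
  obtain ⟨hd, B, hB, hB', hgB⟩ := g.2
  choose! c n hcn using fun b hb => isDyadicPoint_iff.1 (hB' b hb)
  obtain ⟨N, hN⟩ := exists_common_exponent hB n
  have h2 : (0 : ℝ) < 2 ^ N := by positivity
  refine ⟨N, fun a => ?_⟩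
  obtain ⟨k, hk⟩ := affine_of_locally_affine (f := fun x : ℝ => g.1 x)
    (g.1.continuous.comp (AddCircle.continuous_mk' 1)) (u := a / 2 ^ N) (v := (a + 1) / 2 ^ N)
    (by gcongr; linarith) (by
      intro t ht
      have htB : (t : UnitAddCircle) ∉ B := by
        intro hb
        have h1 := hcn _ hb
        rw [coe_div_two_pow_of_le (hN _ hb)] at h1
        obtain ⟨z, hz⟩ := coe_eq_coe_iff.1 h1
        rw [div_add' _ _ _ h2.ne'] at hz
        rw [hz, Set.mem_Ioo, div_lt_div_iff_of_pos_right h2, div_lt_div_iff_of_pos_right h2] at ht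
        obtain ⟨h3, h4⟩ := ht
        norm_cast at h3 h4
        omega
      obtain ⟨k, hk⟩ := hgB _ htB
      refine ⟨k, ?_⟩
      filter_upwards [hk] with s hs
      rw [AddCircle.coe_add]
      exact hs)
  refine ⟨k - N, fun t h0 h1 => ?_⟩
  have := hk ((a + t) / 2 ^ N) ⟨by gcongr; linarith, by gcongr⟩
  rw [this, zpow_sub₀ two_ne_zero, zpow_natCast]
  congr 2
  ring

/-- An element of `T` maps the intervals of some subdivision of the circle into dyadic intervals of
equal length affinely to intervals with dyadic end points. -/
theorem exists_subdivision (g : T) : ∃ N M : ℕ, ∀ a : ℤ,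
    (∃ b : ℤ, g.1 ((a / 2 ^ N : ℝ)) = ((b / 2 ^ M : ℝ))) ∧
    ∃ j : ℕ, ∀ t : ℝ, 0 ≤ t → t ≤ 1 →
      g.1 (((a + t) / 2 ^ N : ℝ)) = g.1 ((a / 2 ^ N : ℝ)) + ((2 ^ j * t / 2 ^ M : ℝ)) := by
  obtain ⟨N, hN⟩ := exists_affine g
  choose k hk using hN
  have hd (a : ℤ) : ∃ (b : ℤ) (n : ℕ), g.1 ((a / 2 ^ N : ℝ)) = ((b / 2 ^ n : ℝ)) :=
    isDyadicPoint_iff.1 ((g.2.1 _).2 (isDyadicPoint_iff.2 ⟨a, N, rfl⟩))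
  choose b n hbn using hd
  -- By periodicity finitely many indices suffice. The exponent `n a` puts image end points in `2⁻ᴹ
  -- ℤ`, and `|k a|` makes `k a + M` nonnegative.
  obtain ⟨M, hM⟩ := exists_common_exponent (Set.finite_Ico (0 : ℤ) (2 ^ N))
    fun a => n a + (k a).natAbs
  have h2 : (2 : ℝ) ^ N ≠ 0 := by positivity
  have hper (a : ℤ) (t : ℝ) : (((a + t) / 2 ^ N : ℝ) : UnitAddCircle) =
      ((((a % 2 ^ N : ℤ) + t) / 2 ^ N : ℝ)) := by
    refine coe_eq_coe_iff.2 ⟨a / 2 ^ N, ?_⟩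
    rw [div_add' _ _ _ h2]
    congr 1
    have := Int.emod_add_mul_ediv a (2 ^ N)
    have h3 : (a : ℝ) = ((a % 2 ^ N + 2 ^ N * (a / 2 ^ N) : ℤ) : ℝ) := by rw [this]
    rw [h3]
    push_cast
    ring
  have hper0 (a : ℤ) : ((a / 2 ^ N : ℝ) : UnitAddCircle) = (((a % 2 ^ N : ℤ) / 2 ^ N : ℝ)) := by
    simpa using hper a 0
  refine ⟨N, M, fun a => ?_⟩
  have ha : n (a % 2 ^ N) + (k (a % 2 ^ N)).natAbs ≤ M :=
    hM _ ⟨Int.emod_nonneg _ (by positivity), Int.emod_lt_of_pos _ (by positivity)⟩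
  rw [hper0]
  generalize hc : a % 2 ^ N = c at *
  refine ⟨⟨_, by rw [hbn, coe_div_two_pow_of_le (N := M) (by omega)]⟩, (k c + M).toNat,
    fun t h0 h1 => ?_⟩
  rw [hper, hc, hk c t h0 h1]
  congr 2
  rw [← zpow_natCast, Int.toNat_of_nonneg (by omega), zpow_add₀ two_ne_zero, zpow_natCast]
  field_simp

/-! ### Generation of `T` -/

theorem split_inv_add_mul (n : ℕ) (q : ℤ) (x : ℝ) :
    (split n)⁻¹ (x + (n + 2) * q) = (split n)⁻¹ x + (n + 1) * q := by
  apply (split n).injective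
  rw [RelIso.apply_inv_self, split_add_mul, RelIso.apply_inv_self]

theorem split_inv_of_le_two (n : ℕ) {x : ℝ} (h0 : 0 ≤ x) (h1 : x ≤ 2) :
    (split n)⁻¹ x = x / 2 := by
  apply (split n).injective
  rw [RelIso.apply_inv_self, split_of_le_one _ (by linarith) (by linarith)]
  ring

theorem split_inv_of_two_le (n : ℕ) {x : ℝ} (h0 : 2 ≤ x) (h1 : x ≤ n + 2) :
    (split n)⁻¹ x = x - 1 := by
  apply (split n).injective
  rw [RelIso.apply_inv_self, split_of_one_le _ (by linarith) (by linarith)]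
  ring

/-- The map `f` is the composition of the projection of the line to the circle of length `n + 1`
with an injective map to `ℝ / ℤ` that maps each unit interval affinely to an interval with end
points in `2⁻ᴹ ℤ`, and expands it by a power of `2` after scaling by `2ᴹ`. -/
structure IsDyadicSubdivision (M n : ℕ) (f : ℝ → UnitAddCircle) : Prop where
  eq_iff : ∀ x y, f x = f y ↔ ∃ z : ℤ, x = y + (n + 1) * z
  apply_int : ∀ a : ℤ, ∃ b : ℤ, f a = ((b / 2 ^ M : ℝ) : UnitAddCircle)
  affine : ∀ a : ℤ, ∃ j : ℕ, ∀ t : ℝ, 0 ≤ t → t ≤ 1 →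
    f (a + t) = f a + ((2 ^ j * t / 2 ^ M : ℝ) : UnitAddCircle)

namespace IsDyadicSubdivision

variable {M n : ℕ} {f : ℝ → UnitAddCircle}

/-- The images of the `n + 1` leaf end points are distinct classes of `2⁻ᴹ ℤ` modulo `ℤ`. This bound
ends the splitting process. -/
theorem le_two_pow (hf : IsDyadicSubdivision M n f) : n + 1 ≤ 2 ^ M := by
  choose b hb using hf.apply_int
  have hinj : Function.Injective fun i : Fin (n + 1) => ((b (i : ℕ) : ℤ) : ZMod (2 ^ M)) := by
    intro i j hij
    have h1 := (ZMod.intCast_eq_intCast_iff_dvd_sub _ _ _).1 hij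
    obtain ⟨z, hz⟩ := h1
    have h2 : f ((j : ℕ) : ℤ) = f ((i : ℕ) : ℤ) := by
      rw [hb, hb]
      refine coe_eq_coe_iff.2 ⟨z, ?_⟩
      rw [div_add' _ _ _ (by positivity)]
      congr 1
      have h3 : ((b (j : ℕ) - b (i : ℕ) : ℤ) : ℝ) = (((2 ^ M : ℕ) : ℤ) * z : ℤ) := by rw [hz]
      push_cast at h3
      linarith
    obtain ⟨w, hw⟩ := (hf.eq_iff _ _).1 h2
    have hw' : ((j : ℕ) : ℤ) = (i : ℕ) + (n + 1) * w := by exact_mod_cast hw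
    have hi := i.2
    have hj := j.2
    have hw0 : w = 0 := by
      by_contra hne
      rcases lt_or_gt_of_ne hne with h | h
      · have : ((n : ℤ) + 1) * w ≤ (n + 1) * (-1) := by gcongr; omega
        omega
      · have : ((n : ℤ) + 1) * 1 ≤ (n + 1) * w := by gcongr; omega
        omega
    rw [hw0, mul_zero, add_zero] at hw'
    exact Fin.ext (by omega)
  simpa [ZMod.card] using Fintype.card_le_of_injective _ hinj

/-- A leaf with expansion exponent `j + 1` is halved into two leaves with exponent `j`; every other
leaf keeps its exponent. -/
theorem comp_split (hf : IsDyadicSubdivision M n f) {a : ℤ} {j : ℕ}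
    (hj : ∀ t : ℝ, 0 ≤ t → t ≤ 1 →
      f (a + t) = f a + ((2 ^ (j + 1) * t / 2 ^ M : ℝ) : UnitAddCircle)) :
    IsDyadicSubdivision M (n + 1) fun x => f (a + (split n)⁻¹ x) := by
  have heq (x y : ℝ) : f (a + (split n)⁻¹ x) = f (a + (split n)⁻¹ y) ↔
      ∃ z : ℤ, x = y + ((n + 1 : ℕ) + 1) * z := by
    rw [hf.eq_iff]
    refine exists_congr fun z => ?_
    rw [add_assoc, add_right_inj, ← split_inv_add_mul, (split n)⁻¹.injective.eq_iff]
    push_cast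
    rw [show (n : ℝ) + 1 + 1 = n + 2 by ring]
  have hred (c : ℤ) : ∃ c₀ : ℤ, 0 ≤ c₀ ∧ c₀ < n + 2 ∧
      ∀ t : ℝ, f (a + (split n)⁻¹ (c + t)) = f (a + (split n)⁻¹ (c₀ + t)) := by
    refine ⟨c % (n + 2), Int.emod_nonneg _ (by positivity), Int.emod_lt_of_pos _ (by positivity),
      fun t => (heq _ _).2 ⟨c / (n + 2), ?_⟩⟩
    have h1 := Int.emod_add_mul_ediv c (n + 2)
    have h2 : (c : ℝ) = ((c % (n + 2) + (n + 2) * (c / (n + 2)) : ℤ) : ℝ) := by rw [h1]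
    rw [h2]
    push_cast
    ring
  have hpiece (c : ℤ) : (∃ b : ℤ, f (a + (split n)⁻¹ c) = ((b / 2 ^ M : ℝ) : UnitAddCircle)) ∧
      ∃ j : ℕ, ∀ t : ℝ, 0 ≤ t → t ≤ 1 → f (a + (split n)⁻¹ (c + t)) =
        f (a + (split n)⁻¹ c) + ((2 ^ j * t / 2 ^ M : ℝ) : UnitAddCircle) := by
    obtain ⟨c₀, h0, h1, h⟩ := hred c
    have hc := h 0
    rw [add_zero, add_zero] at hc
    simp only [h, hc]
    obtain ⟨b, hb⟩ := hf.apply_int a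
    have hn : (0 : ℝ) ≤ n := by positivity
    rcases (show c₀ = 0 ∨ c₀ = 1 ∨ 2 ≤ c₀ by omega) with rfl | rfl | h2
    · have e0 : f (a + (split n)⁻¹ ((0 : ℤ) : ℝ)) = f a := by
        rw [split_inv_of_le_two n (by simp) (by simp)]; simp
      rw [e0]
      refine ⟨⟨b, hb⟩, j, fun t ht0 ht1 => ?_⟩
      rw [Int.cast_zero, zero_add, split_inv_of_le_two n ht0 (by linarith),
        hj _ (by linarith) (by linarith)]
      congr 2
      rw [pow_succ]; ring
    · have e1 (t : ℝ) (ht0 : 0 ≤ t) (ht1 : t ≤ 1) : f (a + (split n)⁻¹ ((1 : ℤ) + t)) =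
          f a + ((2 ^ j / 2 ^ M + 2 ^ j * t / 2 ^ M : ℝ) : UnitAddCircle) := by
        rw [Int.cast_one, split_inv_of_le_two n (by linarith) (by linarith),
          hj _ (by linarith) (by linarith)]
        congr 2
        rw [pow_succ]; ring
      have e0 := e1 0 le_rfl zero_le_one
      rw [add_zero, mul_zero, zero_div, add_zero] at e0
      rw [e0]
      refine ⟨⟨b + 2 ^ j, ?_⟩, j, fun t ht0 ht1 => ?_⟩
      · rw [hb, ← AddCircle.coe_add, ← add_div]
        push_cast; rfl
      · rw [e1 t ht0 ht1, AddCircle.coe_add, add_assoc]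
    · have h1' : (c₀ : ℝ) + 1 ≤ n + 2 := by exact_mod_cast h1
      have h2' : (2 : ℝ) ≤ c₀ := by exact_mod_cast h2
      have e1 (t : ℝ) (ht0 : 0 ≤ t) (ht1 : t ≤ 1) : f (a + (split n)⁻¹ (c₀ + t)) =
          f ((a + c₀ - 1 : ℤ) + t) := by
        rw [split_inv_of_two_le n (by linarith) (by linarith)]
        congr 1
        push_cast; ring
      have e0 := e1 0 le_rfl zero_le_one
      rw [add_zero, add_zero] at e0
      rw [e0]
      refine ⟨hf.apply_int _, ?_⟩
      obtain ⟨i, hi⟩ := hf.affine (a + c₀ - 1)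
      exact ⟨i, fun t ht0 ht1 => by rw [e1 t ht0 ht1, hi t ht0 ht1]⟩
  exact ⟨heq, fun c => (hpiece c).1, fun c => (hpiece c).2⟩

/-- Unit slopes add up to a global affine formula; the periods `n + 1` and `2 ^ M` of that formula
then divide each other. -/
theorem eq_of_slope_one (hf : IsDyadicSubdivision M n f)
    (h : ∀ (a : ℤ) (t : ℝ), 0 ≤ t → t ≤ 1 →
      f (a + t) = f a + ((t / 2 ^ M : ℝ) : UnitAddCircle)) :
    n = 2 ^ M - 1 ∧ ∃ b : ℤ, ∀ x, f x = (((x + b) / 2 ^ M : ℝ) : UnitAddCircle) := by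
  obtain ⟨b, hb⟩ := hf.apply_int 0
  have hint (a : ℤ) : f a = (((a + b) / 2 ^ M : ℝ) : UnitAddCircle) := by
    induction a using Int.induction_on with
    | zero => rw [hb]; simp
    | succ a ih =>
      have := h a 1 zero_le_one le_rfl
      push_cast at this ih ⊢
      rw [this, ih, ← AddCircle.coe_add]
      congr 1; ring
    | pred a ih =>
      have := h (-a - 1) 1 zero_le_one le_rfl
      rw [show (((-a - 1 : ℤ) : ℝ) + 1) = ((-a : ℤ) : ℝ) by push_cast; ring, ih,
        ← sub_eq_iff_eq_add, ← AddCircle.coe_sub] at this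
      rw [← this]
      push_cast
      congr 1; ring
  have hall (x : ℝ) : f x = (((x + b) / 2 ^ M : ℝ) : UnitAddCircle) := by
    have := h ⌊x⌋ (Int.fract x) (Int.fract_nonneg x) (Int.fract_lt_one x).le
    rw [Int.floor_add_fract, hint, ← AddCircle.coe_add] at this
    rw [this]
    congr 1
    rw [← add_div]
    congr 1
    linarith [Int.floor_add_fract x]
  have h2 : (2 : ℝ) ^ M ≠ 0 := by positivity
  refine ⟨?_, b, hall⟩
  obtain ⟨w, hw⟩ := (hf.eq_iff (2 ^ M) 0).1 (by
    rw [hall, hall]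
    exact coe_eq_coe_iff.2 ⟨1, by field_simp; push_cast; ring⟩)
  have h3 : f ((n + 1 : ℕ) : ℝ) = f 0 := (hf.eq_iff _ _).2 ⟨1, by push_cast; ring⟩
  rw [hall, hall] at h3
  obtain ⟨z, hz⟩ := coe_eq_coe_iff.1 h3
  have h4 : (2 ^ M : ℕ) ∣ (n + 1) := by
    rw [← Int.natCast_dvd_natCast]
    refine ⟨z, ?_⟩
    field_simp at hz
    have : ((n + 1 : ℕ) : ℝ) = 2 ^ M * z := by push_cast at hz ⊢; linarith
    exact_mod_cast this
  have h5 : (n + 1) ∣ (2 ^ M : ℕ) := by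
    rw [← Int.natCast_dvd_natCast]
    refine ⟨w, ?_⟩
    rw [zero_add] at hw
    exact_mod_cast hw
  have := Nat.dvd_antisymm h4 h5
  omega

/-- Induction on the room left for further leaves below `2 ^ M`. A leaf that is expanded is rotated
to position `0` by a power of `liftRot n` and split. If none exists, the image is the uniform
subdivision, which `completeTree` compares with the vine. -/
theorem exists_lift (d : ℕ) : ∀ {n : ℕ} {f : ℝ → UnitAddCircle}, IsDyadicSubdivision M n f →
    2 ^ M < n + 1 + d → ∃ φ ∈ Subgroup.closure (Set.range liftRot),
      ∀ x, f (vine n x) = (φ.1 x : UnitAddCircle) := by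
  have hm (n : ℕ) (k : ℤ) : liftRot n ^ k ∈ Subgroup.closure (Set.range liftRot) :=
    zpow_mem (Subgroup.subset_closure (Set.mem_range_self n)) k
  have hrot (n : ℕ) (k : ℤ) (x : ℝ) : (liftRot n ^ k).1 x = (vine n)⁻¹ (vine n x + k) := by
    rw [Subgroup.coe_zpow, liftRot, vineRot_zpow, RelIso.mul_apply, RelIso.mul_apply,
      unitShift_zpow_apply]
  induction d with
  | zero =>
    intro n f hf hd
    exact absurd hf.le_two_pow (by omega)
  | succ d ih =>
    intro n f hf hd
    by_cases h : ∃ (a : ℤ) (j : ℕ), ∀ t : ℝ, 0 ≤ t → t ≤ 1 →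
        f (a + t) = f a + ((2 ^ (j + 1) * t / 2 ^ M : ℝ) : UnitAddCircle)
    · obtain ⟨a, j, hj⟩ := h
      obtain ⟨φ, hφ, h⟩ := ih (hf.comp_split hj) (by omega)
      refine ⟨φ * liftRot n ^ (-a), mul_mem hφ (hm _ _), fun x => ?_⟩
      rw [Subgroup.coe_mul, RelIso.mul_apply, ← h, hrot, vine, RelIso.mul_apply,
        RelIso.inv_apply_self, RelIso.apply_inv_self]
      congr 1
      push_cast; ring
    · obtain ⟨rfl, b, hb⟩ := hf.eq_of_slope_one fun a => by
        obtain ⟨j, hj⟩ := hf.affine a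
        cases j with
        | zero => simpa using hj
        | succ j => exact absurd ⟨a, j, hj⟩ h
      refine ⟨(completeTree liftRot M)⁻¹ * liftRot (2 ^ M - 1) ^ b,
        mul_mem (inv_mem (completeTree_mem_closure M)) (hm _ _), fun x => ?_⟩
      rw [Subgroup.coe_mul, RelIso.mul_apply, hrot, InvMemClass.coe_inv, coe_completeTree_liftRot,
        completeTree_vineRot, mul_inv_rev, inv_inv, RelIso.mul_apply, RelIso.apply_inv_self,
        split_zero_pow_inv_apply, hb]

end IsDyadicSubdivision

theorem exists_proj_eq (g : T) : ∃ φ ∈ Subgroup.closure (Set.range liftRot), proj φ = g := by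
  obtain ⟨N, M, h⟩ := exists_subdivision g
  have h2 : (2 : ℝ) ^ N ≠ 0 := by positivity
  have hN : (((2 ^ N - 1 : ℕ) : ℝ) + 1) = 2 ^ N := by
    rw [Nat.cast_sub Nat.one_le_two_pow]; push_cast; ring
  have hf : IsDyadicSubdivision M (2 ^ N - 1) fun x : ℝ => g.1 ((x / 2 ^ N : ℝ)) := by
    refine ⟨fun x y => ?_, fun a => (h a).1, fun a => (h a).2⟩
    rw [g.1.injective.eq_iff, coe_eq_coe_iff, hN]
    refine exists_congr fun z => ?_
    field_simp
  obtain ⟨φ, hφ, h⟩ := hf.exists_lift (2 ^ M) (by omega)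
  refine ⟨φ * completeTree liftRot N, mul_mem hφ (completeTree_mem_closure N), ?_⟩
  ext x
  induction x using QuotientAddGroup.induction_on with
  | H x =>
    refine (proj_coe _ x).trans ?_
    rw [Subgroup.coe_mul, RelIso.mul_apply, ← h, coe_completeTree_liftRot, completeTree_vineRot,
      RelIso.mul_apply, RelIso.apply_inv_self, split_zero_pow_apply, mul_div_cancel_left₀ _ h2]

theorem closure_eq_top :
    Subgroup.closure {proj (liftRot 1), proj (liftRot 2), proj (liftRot 3)} = ⊤ := by
  rw [eq_top_iff]
  intro g _
  obtain ⟨φ, hφ, rfl⟩ := exists_proj_eq g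
  have hle : Subgroup.closure (Set.range liftRot) ≤
      (Subgroup.closure {proj (liftRot 1), proj (liftRot 2), proj (liftRot 3)}).comap proj := by
    rw [Subgroup.closure_le]
    rintro _ ⟨n, rfl⟩
    refine cyclicTower_liftRot.mem_of_mem ?_ ?_ ?_ n <;>
      exact Subgroup.subset_closure (by simp)
  exact hle hφ

theorem fg_T : Group.FG T :=
  Group.fg_iff.2 ⟨_, closure_eq_top, by simp⟩

/-! ### Word length -/

section WordLength

variable {G : Type*} [Group G] {S : Set G}

theorem exists_word (hS : Subgroup.closure S = ⊤) (g : G) :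
    ∃ w : List G, (∀ s ∈ w, s ∈ S ∨ s⁻¹ ∈ S) ∧ w.prod = g ∧ w.length = wordLength S g := by
  have hmem : g ∈ (Subgroup.closure S).toSubmonoid := by rw [hS]; exact Subgroup.mem_top g
  rw [Subgroup.closure_toSubmonoid] at hmem
  obtain ⟨w, hw, hg⟩ := Submonoid.exists_list_of_mem_closure hmem
  exact Nat.sInf_mem (s := {n | ∃ w : List G, (∀ s ∈ w, s ∈ S ∨ s⁻¹ ∈ S) ∧ w.prod = g ∧
    w.length = n}) ⟨_, w, hw, hg, rfl⟩

theorem wordLength_le {w : List G} (hw : ∀ s ∈ w, s ∈ S ∨ s⁻¹ ∈ S) :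
    wordLength S w.prod ≤ w.length := Nat.sInf_le ⟨w, hw, rfl, rfl⟩

theorem isLength_wordLength (hS : Subgroup.closure S = ⊤) : IsLength (wordLength S) where
  one := Nat.le_zero.1 (wordLength_le (S := S) (w := []) (by simp))
  mul a b := by
    obtain ⟨u, hu, rfl, hul⟩ := exists_word hS a
    obtain ⟨v, hv, rfl, hvl⟩ := exists_word hS b
    rw [← hul, ← hvl, ← List.prod_append, ← List.length_append]
    refine wordLength_le fun s hs => ?_
    rcases List.mem_append.1 hs with h | h
    · exact hu s h
    · exact hv s h
  inv a := by
    obtain ⟨u, hu, rfl, hul⟩ := exists_word hS a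
    rw [← hul, List.prod_inv_reverse]
    refine (wordLength_le fun s hs => ?_).trans (by simp)
    simp only [List.mem_reverse, List.mem_map] at hs
    obtain ⟨a, ha, rfl⟩ := hs
    rw [inv_inv]
    exact (hu a ha).symm

theorem le_mul_wordLength (hS : Subgroup.closure S = ⊤) {b : G → ℕ} (h1 : b 1 = 0)
    (hmul : ∀ g h, b (g * h) ≤ b g + b h) {K : ℕ} (hK : ∀ s ∈ S, b s ≤ K ∧ b s⁻¹ ≤ K) (g : G) :
    b g ≤ K * wordLength S g := by
  obtain ⟨w, hw, rfl, hl⟩ := exists_word hS g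
  rw [← hl]
  clear hl
  induction w with
  | nil => simp [h1]
  | cons s w ih =>
    have e1 := ih fun t ht => hw t (List.mem_cons_of_mem _ ht)
    have e2 : b s ≤ K := by
      rcases hw s List.mem_cons_self with h | h
      · exact (hK s h).1
      · simpa using (hK _ h).2
    rw [List.prod_cons, List.length_cons, mul_add, mul_one]
    exact (hmul _ _).trans (by omega)

end WordLength

/-! ### Dyadic arcs that are not mapped affinely to dyadic arcs -/

/-- The pairs that consist of the depth and the left end point of a standard dyadic arc. -/
def dyadicArcs : Set (ℕ × UnitAddCircle) :=
  {p | ∃ a : ℤ, p.2 = ((a / 2 ^ p.1 : ℝ) : UnitAddCircle)}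

/-- The map `g` maps the arc `p` affinely onto the arc `q`. -/
def MapsArc (g : T) (p q : ℕ × UnitAddCircle) : Prop :=
  ∀ t : ℝ, 0 ≤ t → t ≤ 1 →
    g.1 (p.2 + ((t / 2 ^ p.1 : ℝ) : UnitAddCircle)) = q.2 + ((t / 2 ^ q.1 : ℝ) : UnitAddCircle)

/-- The standard dyadic arcs that `g` does not map affinely onto a standard dyadic arc. -/
def badArcs (g : T) : Set (ℕ × UnitAddCircle) :=
  {p ∈ dyadicArcs | ∀ q ∈ dyadicArcs, ¬ MapsArc g p q}

/-- Half the length of an arc lies in `(0, 1/2]`, so it is determined by its class modulo `1`. Later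
uses evaluate at the midpoint for this reason. -/
theorem eq_of_half_div_eq {m n : ℕ}
    (h : ((1 / 2 / 2 ^ m : ℝ) : UnitAddCircle) = ((1 / 2 / 2 ^ n : ℝ))) : m = n := by
  obtain ⟨z, hz⟩ := coe_eq_coe_iff.1 h
  have hb (k : ℕ) : 0 < (1 / 2 / 2 ^ k : ℝ) ∧ (1 / 2 / 2 ^ k : ℝ) ≤ 1 / 2 :=
    ⟨by positivity, div_le_self (by norm_num) (one_le_pow₀ (by norm_num))⟩
  obtain ⟨h1, h2⟩ := hb m
  obtain ⟨h3, h4⟩ := hb n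
  have h5 : (-1 : ℝ) < z := by linarith
  have h6 : (z : ℝ) < 1 := by linarith
  have h7 : z = 0 := by
    have h5' : (-1 : ℤ) < z := by exact_mod_cast h5
    have h6' : z < 1 := by exact_mod_cast h6
    omega
  rw [h7, Int.cast_zero, add_zero] at hz
  have h8 : (2 : ℝ) ^ m = 2 ^ n := by field_simp at hz; exact hz.symm
  exact Nat.pow_right_injective le_rfl (by exact_mod_cast h8)

theorem MapsArc.eq_left {g : T} {p p' q : ℕ × UnitAddCircle} (h : MapsArc g p q)
    (h' : MapsArc g p' q) : p = p' := by
  have e (t : ℝ) (h0 : 0 ≤ t) (h1 : t ≤ 1) : p.2 + ((t / 2 ^ p.1 : ℝ) : UnitAddCircle) =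
      p'.2 + ((t / 2 ^ p'.1 : ℝ) : UnitAddCircle) :=
    g.1.injective ((h t h0 h1).trans (h' t h0 h1).symm)
  have e0 : p.2 = p'.2 := by simpa using e 0 le_rfl zero_le_one
  have e1 := e (1 / 2) (by norm_num) (by norm_num)
  rw [e0] at e1
  exact Prod.ext (eq_of_half_div_eq (add_left_cancel e1)) e0

theorem MapsArc.comp {f g : T} {p q r : ℕ × UnitAddCircle} (hf : MapsArc f q r)
    (hg : MapsArc g p q) : MapsArc (f * g) p r := fun t h0 h1 =>
  (congrArg f.1 (hg t h0 h1)).trans (hf t h0 h1)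

theorem badArcs_one : badArcs 1 = ∅ := by
  ext p
  simp only [badArcs, Set.mem_sep_iff, Set.mem_empty_iff_false, iff_false, not_and, not_forall,
    not_not]
  exact fun hp => ⟨p, hp, fun t _ _ => rfl⟩

theorem finite_arcs_lt (L : ℕ) : {p ∈ dyadicArcs | p.1 < L}.Finite := by
  refine (((Set.finite_Iio L).prod (Set.finite_Ico (0 : ℤ) (2 ^ L))).image fun x : ℕ × ℤ =>
    (x.1, ((x.2 / 2 ^ x.1 : ℝ) : UnitAddCircle))).subset ?_
  rintro ⟨m, x⟩ ⟨⟨a, ha⟩, hm⟩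
  simp only at ha hm
  refine ⟨(m, a % 2 ^ m), ⟨hm, Int.emod_nonneg _ (by positivity), ?_⟩, Prod.ext rfl ?_⟩
  · exact (Int.emod_lt_of_pos _ (by positivity)).trans_le
      (pow_le_pow_right₀ (by norm_num) hm.le)
  · simp only
    rw [ha]
    refine coe_eq_coe_iff.2 ⟨-(a / 2 ^ m), ?_⟩
    rw [div_add' _ _ _ (by positivity)]
    congr 1
    have h1 := Int.emod_add_mul_ediv a (2 ^ m)
    have h3 : (a : ℝ) = ((a % 2 ^ m + 2 ^ m * (a / 2 ^ m) : ℤ) : ℝ) := by rw [h1]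
    rw [h3]
    push_cast
    ring

/-- Arcs of depth at least `N + M` lie in one affine piece of `g` and are so short that their images
are again standard. -/
theorem finite_badArcs (g : T) : (badArcs g).Finite := by
  obtain ⟨N, M, h⟩ := exists_subdivision g
  refine (finite_arcs_lt (N + M)).subset ?_
  rintro ⟨m, x⟩ ⟨⟨a, ha⟩, hbad⟩
  simp only at ha
  refine ⟨⟨a, ha⟩, ?_⟩
  by_contra hm
  simp only [not_lt] at hm
  obtain ⟨e, rfl⟩ := Nat.exists_eq_add_of_le hm
  set c := a / 2 ^ (M + e) with hc
  set i := a % 2 ^ (M + e) with hi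
  have hai : (a : ℝ) = i + 2 ^ (M + e) * c := by
    have h1 := Int.emod_add_mul_ediv a (2 ^ (M + e))
    rw [← hc, ← hi] at h1
    exact_mod_cast h1.symm
  have hi0 : 0 ≤ i := Int.emod_nonneg _ (by positivity)
  have hi1 : i < 2 ^ (M + e) := Int.emod_lt_of_pos _ (by positivity)
  obtain ⟨⟨b, hb⟩, j, hj⟩ := h c
  -- If `j > M`, the image of a single piece would return to its starting point, contradicting
  -- injectivity.
  have hjM : j ≤ M := by
    by_contra hlt
    obtain ⟨d, rfl⟩ := Nat.exists_eq_add_of_lt (not_le.1 hlt)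
    have hd : (1 : ℝ) ≤ 2 ^ d := one_le_pow₀ (by norm_num)
    have ht1 : (1 / 2 ^ (d + 1) : ℝ) < 1 := by
      rw [div_lt_one (by positivity), pow_succ]; linarith
    have h1 := hj (1 / 2 ^ (d + 1)) (by positivity) ht1.le
    have h2 : (2 ^ (M + d + 1) * (1 / 2 ^ (d + 1)) / 2 ^ M : ℝ) = 0 + (1 : ℤ) := by
      rw [add_assoc M d 1, pow_add 2 M (d + 1)]; field_simp; simp
    rw [h2, coe_add_intCast, AddCircle.coe_zero, add_zero] at h1
    obtain ⟨z, hz⟩ := coe_eq_coe_iff.1 (g.1.injective h1)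
    have h3 : (1 / 2 ^ (d + 1) / 2 ^ N : ℝ) = z := by
      rw [add_div] at hz; linarith
    have h4 : (1 / 2 ^ (d + 1) / 2 ^ N : ℝ) < 1 :=
      (div_le_self (by positivity) (one_le_pow₀ (by norm_num))).trans_lt ht1
    have h5 : (0 : ℝ) < 1 / 2 ^ (d + 1) / 2 ^ N := by positivity
    rw [h3] at h4 h5
    have h4' : z < 1 := by exact_mod_cast h4
    have h5' : 0 < z := by exact_mod_cast h5
    omega
  obtain ⟨l, rfl⟩ := Nat.exists_eq_add_of_le hjM
  have key (t : ℝ) (h0 : 0 ≤ t) (h1 : t ≤ 1) :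
      g.1 (((a + t) / 2 ^ (N + (j + l) + e) : ℝ)) =
        (((b + i / 2 ^ (l + e)) / 2 ^ (j + l) + t / 2 ^ (j + l + (l + e)) : ℝ)) := by
    have hi1' : (i : ℝ) + 1 ≤ 2 ^ (j + l + e) := by exact_mod_cast hi1
    have hi0' : (0 : ℝ) ≤ i := by exact_mod_cast hi0
    have h2 := hj ((i + t) / 2 ^ (j + l + e)) (by positivity)
      ((div_le_one (by positivity)).2 (by linarith))
    rw [hb, ← AddCircle.coe_add] at h2
    have e1 : (a + t) / (2 : ℝ) ^ (N + (j + l) + e) =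
        (c + (i + t) / 2 ^ (j + l + e)) / 2 ^ N := by
      rw [hai]
      field_simp
      ring
    have e2 : (b + i / (2 : ℝ) ^ (l + e)) / 2 ^ (j + l) + t / 2 ^ (j + l + (l + e)) =
        b / 2 ^ (j + l) + 2 ^ j * ((i + t) / 2 ^ (j + l + e)) / 2 ^ (j + l) := by
      simp only [pow_add]
      field_simp
      ring
    rw [e1, e2, h2]
  refine hbad (j + l + (l + e), g.1 x) ⟨b * 2 ^ (l + e) + i, ?_⟩ fun t h0 h1 => ?_
  · have := key 0 le_rfl zero_le_one
    rw [add_zero, zero_div, add_zero, ← ha] at this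
    simp only
    rw [this]
    congr 1
    push_cast
    field_simp
    ring
  · have h2 := key 0 le_rfl zero_le_one
    rw [add_zero, zero_div, add_zero, ← ha] at h2
    simp only
    rw [h2, ← AddCircle.coe_add, ← key t h0 h1, ha, ← AddCircle.coe_add, ← add_div]

/-- An arc bad for `f * g` is bad for `g`, or `g` carries it onto an arc bad for `f`. In the second
case it is determined by its image, and `F` recovers it. -/
theorem ncard_badArcs_mul_le (f g : T) :
    (badArcs (f * g)).ncard ≤ (badArcs f).ncard + (badArcs g).ncard := by
  classical
  let F : ℕ × UnitAddCircle → ℕ × UnitAddCircle := fun q =>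
    if h : ∃ p, MapsArc g p q then h.choose else q
  have hsub : badArcs (f * g) ⊆ F '' badArcs f ∪ badArcs g := by
    rintro p ⟨hp, hbad⟩
    by_cases h : p ∈ badArcs g
    · exact Or.inr h
    · have : ∃ q ∈ dyadicArcs, MapsArc g p q := by
        by_contra hne
        push Not at hne
        exact h ⟨hp, hne⟩
      obtain ⟨q, hq, hpq⟩ := this
      refine Or.inl ⟨q, ⟨hq, fun r hr hqr => hbad r hr (hqr.comp hpq)⟩, ?_⟩
      have hex : ∃ p, MapsArc g p q := ⟨p, hpq⟩
      simp only [F, dif_pos hex]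
      exact hex.choose_spec.eq_left hpq
  calc _ ≤ (F '' badArcs f ∪ badArcs g).ncard :=
        Set.ncard_le_ncard hsub (((finite_badArcs f).image F).union (finite_badArcs g))
    _ ≤ (F '' badArcs f).ncard + (badArcs g).ncard := Set.ncard_union_le _ _
    _ ≤ _ := Nat.add_le_add_right (Set.ncard_image_le (finite_badArcs f)) _

/-- A rotation preserves lengths, so a standard image of an arc of depth `m` has depth `m`;
comparing left end points then contradicts the parity of `r`. -/
theorem two_pow_le_ncard_badArcs {g : T} {r : ℤ} (hr : Odd r) (m : ℕ)
    (hg : ∀ x, g.1 x = x + ((r / 2 ^ (m + 1) : ℝ) : UnitAddCircle)) :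
    2 ^ m ≤ (badArcs g).ncard := by
  let F : ℕ → ℕ × UnitAddCircle := fun i => (m, ((i / 2 ^ m : ℝ) : UnitAddCircle))
  have hinj : Set.InjOn F (Finset.range (2 ^ m)) := by
    intro i hi j hj hij
    simp only [Finset.coe_range, Set.mem_Iio] at hi hj
    obtain ⟨z, hz⟩ := coe_eq_coe_iff.1 (Prod.ext_iff.1 hij).2
    rw [div_add' _ _ _ (by positivity), div_left_inj' (by positivity)] at hz
    have hz' : (i : ℤ) = j + z * 2 ^ m := by exact_mod_cast hz
    have hi' : (i : ℤ) < 2 ^ m := by exact_mod_cast hi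
    have hj' : (j : ℤ) < 2 ^ m := by exact_mod_cast hj
    have := congrArg (· % (2 ^ m : ℤ)) hz'
    simp only [Int.add_mul_emod_self_right] at this
    rw [Int.emod_eq_of_lt (by positivity) hi', Int.emod_eq_of_lt (by positivity) hj'] at this
    exact_mod_cast this
  have hsub : F '' (Finset.range (2 ^ m)) ⊆ badArcs g := by
    rintro _ ⟨i, -, rfl⟩
    refine ⟨⟨i, by simp [F]⟩, ?_⟩
    rintro ⟨n, y⟩ ⟨b, hb⟩ h
    have h0 := h 0 le_rfl zero_le_one
    have h1 := h (1 / 2) (by norm_num) (by norm_num)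
    simp only [F, hg, zero_div, AddCircle.coe_zero, add_zero] at h0 h1 hb
    rw [← h0, add_right_comm] at h1
    have hmn := eq_of_half_div_eq (add_left_cancel h1)
    subst hmn
    rw [hb, ← AddCircle.coe_add] at h0
    obtain ⟨z, hz⟩ := coe_eq_coe_iff.1 h0
    rw [pow_succ] at hz
    field_simp at hz
    have hz' : (i : ℤ) * 2 + r = 2 * (b + 2 ^ m * z) := by exact_mod_cast hz
    obtain ⟨s, rfl⟩ := hr
    omega
  calc 2 ^ m = (F '' (Finset.range (2 ^ m))).ncard := by
        rw [hinj.ncard_image, Set.ncard_coe_finset, Finset.card_range]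
    _ ≤ _ := Set.ncard_le_ncard hsub (finite_badArcs g)

/-! ### Rotations -/

theorem dyadicPoint_add (p q : dyadicRationals) :
    dyadicPoint (p + q) = dyadicPoint p + dyadicPoint q := by simp [dyadicPoint]

theorem dyadicPoint_eq_zero_iff (q : dyadicRationals) :
    dyadicPoint q = 0 ↔ q ∈ integersInDyadic := by
  rw [mem_integersInDyadic, dyadicPoint, ← AddCircle.coe_zero, coe_eq_coe_iff]
  refine exists_congr fun n => ?_
  rw [zero_add, eq_comm]
  exact_mod_cast Iff.rfl

theorem addRight_dyadicPoint_mem (q : dyadicRationals) : Homeomorph.addRight (dyadicPoint q) ∈ T := by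
  refine ⟨fun x => ?_, ∅, Set.finite_empty, by simp, fun x _ => ⟨0, ?_⟩⟩
  · constructor
    · rintro ⟨p, hp⟩
      refine ⟨p - q, ?_⟩
      have h := dyadicPoint_add (p - q) q
      rw [sub_add_cancel] at h
      exact add_right_cancel (hp.trans h)
    · rintro ⟨p, rfl⟩
      exact ⟨p + q, (dyadicPoint_add p q).symm⟩
  · refine Eventually.of_forall fun t => ?_
    simp only [Homeomorph.coe_addRight, zpow_zero, one_mul]
    exact add_right_comm _ _ _

/-- The rotation by a dyadic rational. -/
def rotation (q : dyadicRationals) : R := ⟨⟨_, addRight_dyadicPoint_mem q⟩, q, fun _ => rfl⟩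

theorem rotation_apply (q : dyadicRationals) (x : UnitAddCircle) :
    (rotation q : T).1 x = x + dyadicPoint q := rfl

theorem eq_rotation_iff (g : R) (q : dyadicRationals) :
    g = rotation q ↔ ∀ x, (g : T).1 x = x + dyadicPoint q := by
  refine ⟨fun h x => h ▸ rotation_apply q x, fun h => ?_⟩
  ext x
  rw [h, rotation_apply]

/-- The rotation by a dyadic rational modulo `1`, as a homomorphism. -/
def rotationHom : DyadicModOne →+ Additive R :=
  QuotientAddGroup.lift integersInDyadic
    (AddMonoidHom.mk' (fun q => Additive.ofMul (rotation q)) fun p q => by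
      refine congrArg Additive.ofMul (a₁ := rotation (p + q)) (a₂ := rotation p * rotation q)
        (Eq.symm ((eq_rotation_iff _ _).2 fun x => ?_))
      change x + dyadicPoint q + dyadicPoint p = _
      rw [dyadicPoint_add, add_assoc, add_comm (dyadicPoint q)])
    fun q hq => by
      refine congrArg Additive.ofMul (a₁ := rotation q) (a₂ := 1)
        (Eq.symm ((eq_rotation_iff _ _).2 fun x => ?_))
      rw [(dyadicPoint_eq_zero_iff q).2 hq, add_zero]
      rfl

theorem rotationHom_bijective : Function.Bijective rotationHom := by
  constructor
  · rw [injective_iff_map_eq_zero]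
    intro x
    induction x using QuotientAddGroup.induction_on with
    | H q =>
      intro h
      have h1 : (1 : R) = rotation q := (congrArg Additive.toMul h).symm
      have h2 := (eq_rotation_iff _ _).1 h1 0
      rw [zero_add] at h2
      exact (QuotientAddGroup.eq_zero_iff q).2 ((dyadicPoint_eq_zero_iff q).1 h2.symm)
  · intro g
    obtain ⟨q, hq⟩ := g.toMul.2
    exact ⟨q, congrArg Additive.ofMul ((eq_rotation_iff g.toMul q).2 hq).symm⟩

/-- The isomorphism of the group of rotations with the group of dyadic rationals modulo `1`. -/
def rotationEquiv : R ≃* Multiplicative DyadicModOne :=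
  (AddEquiv.toMultiplicativeLeft (AddEquiv.ofBijective rotationHom rotationHom_bijective)).symm

theorem rotationEquiv_eq_iff (g : R) (q : dyadicRationals) :
    rotationEquiv g = Multiplicative.ofAdd (q : DyadicModOne) ↔
      ∀ x : UnitAddCircle, (g : T).1 x = x + dyadicPoint q := by
  rw [← eq_rotation_iff, rotationEquiv, MulEquiv.symm_apply_eq]
  exact Iff.rfl

/-- A nonzero dyadic rational modulo `1` is represented by a reduced fraction `r / 2 ^ (m + 1)`. -/
theorem exists_eq_div_of_ne_zero {x : DyadicModOne} (hx : x ≠ 0) :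
    ∃ (q : dyadicRationals) (r : ℤ) (m : ℕ), x = q ∧ Odd r ∧ ((q : ℚ) : ℝ) = r / 2 ^ (m + 1) ∧
      modDen x = 2 ^ (m + 1) := by
  obtain ⟨k, hk⟩ := modDen_eq_two_pow x
  induction x using QuotientAddGroup.induction_on with
  | H q =>
    rw [modDen_mk] at hk
    have hq := Rat.num_div_den (q : ℚ)
    match k with
    | 0 =>
      refine absurd ((QuotientAddGroup.eq_zero_iff q).2 (mem_integersInDyadic.2 ⟨(q : ℚ).num, ?_⟩)) hx
      exact Rat.coe_int_num_of_den_eq_one (by simpa using hk)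
    | m + 1 =>
      refine ⟨q, (q : ℚ).num, m, rfl, ?_, ?_, hk⟩
      · have := (q : ℚ).reduced
        rw [hk, Nat.coprime_pow_right_iff (by omega), Nat.coprime_two_right] at this
        exact Int.natAbs_odd.1 this
      · have := congrArg (fun z : ℚ => (z : ℝ)) hq
        rw [hk] at this
        push_cast at this
        exact this.symm

/-! ### The two estimates for rotations and the quasi-isometric embedding -/

theorem wordLength_rotation_le {l : T → ℕ} (hl : IsLength l) :
    ∃ K : ℕ, ∀ (g : T) (r : ℤ) (k : ℕ),
      (∀ x, g.1 x = x + ((r / 2 ^ k : ℝ) : UnitAddCircle)) → l g ≤ K * 2 ^ k := by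
  have hl' : IsLength fun φ => l (proj φ) :=
    ⟨by rw [map_one, hl.one], fun a b => by rw [map_mul]; exact hl.mul _ _,
      fun a => by rw [map_inv]; exact hl.inv _⟩
  set K := l (proj (liftRot 1)) + l (proj (ratio liftRot 1)) + l (proj (ratio liftRot 2)) with hK
  refine ⟨13 * K, fun g r k hg => ?_⟩
  have hr0 : 0 ≤ r % 2 ^ k := Int.emod_nonneg _ (by positivity)
  have hr1 : r % 2 ^ k < 2 ^ k := Int.emod_lt_of_pos _ (by positivity)
  obtain ⟨s, hs⟩ := Int.eq_ofNat_of_zero_le hr0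
  have hs2 : s < 2 ^ k := by rw [hs] at hr1; exact_mod_cast hr1
  have hgs : g = proj ((completeTree liftRot k)⁻¹ * liftRot (2 ^ k - 1) ^ s *
      completeTree liftRot k) := by
    ext x
    induction x using QuotientAddGroup.induction_on with
    | H x =>
      refine (hg _).trans ((Eq.trans ?_ (proj_coe _ x).symm))
      have h := completeTree_conj_apply k s x
      rw [← coe_completeTree_liftRot] at h
      have h' : ((completeTree liftRot k)⁻¹ * liftRot (2 ^ k - 1) ^ s *
        completeTree liftRot k).1 x = x + s / 2 ^ k := h
      rw [h', AddCircle.coe_add]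
      congr 1
      refine coe_eq_coe_iff.2 ⟨r / 2 ^ k, ?_⟩
      rw [div_add' _ _ _ (by positivity)]
      congr 1
      have h1 := Int.emod_add_mul_ediv r (2 ^ k)
      rw [hs] at h1
      have h3 : (r : ℝ) = (((s : ℤ) + 2 ^ k * (r / 2 ^ k) : ℤ) : ℝ) := by
        exact_mod_cast h1.symm
      rw [h3]
      push_cast
      ring
  rw [hgs]
  exact cyclicTower_liftRot.length_conj_le hl' (by omega) (by omega) (by omega) hs2

theorem two_pow_le_wordLength {S : Set T} (hfin : S.Finite) (hS : Subgroup.closure S = ⊤) :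
    ∃ K : ℕ, ∀ (g : T) (r : ℤ) (m : ℕ), Odd r →
      (∀ x, g.1 x = x + ((r / 2 ^ (m + 1) : ℝ) : UnitAddCircle)) →
        2 ^ m ≤ K * wordLength S g := by
  obtain ⟨K, hK⟩ := exists_common_exponent hfin
    fun s => (badArcs s).ncard + (badArcs s⁻¹).ncard
  refine ⟨K, fun g r m hr hg => (two_pow_le_ncard_badArcs hr m hg).trans ?_⟩
  exact le_mul_wordLength hS (b := fun g => (badArcs g).ncard) (by simp [badArcs_one])
    ncard_badArcs_mul_le (fun s hs => ⟨by have := hK s hs; omega, by have := hK s hs; omega⟩) g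

theorem isQuasiIsometricEmbedding_rotation {S : Set T} (hfin : S.Finite)
    (hS : Subgroup.closure S = ⊤) :
    IsQuasiIsometricEmbedding
      (fun g h : R => twoAdicDist (Multiplicative.toAdd (rotationEquiv g))
        (Multiplicative.toAdd (rotationEquiv h)))
      (wordDist S) (fun g : R => (g : T)) := by
  have hl := isLength_wordLength hS
  obtain ⟨A, hA⟩ := wordLength_rotation_le hl
  obtain ⟨B, hB⟩ := two_pow_le_wordLength hfin hS
  have hK : (1 : ℝ) ≤ 1 + A + 2 * B := by
    have : (0 : ℝ) ≤ A + 2 * B := by positivity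
    linarith
  -- For distinct rotations the distance is `2 ^ (m + 1)`: the upper bound needs `A`, and the lower
  -- bound needs `2 * B` because arcs of depth `m` give only `2 ^ m`. No additive error occurs.
  refine ⟨1 + A + 2 * B, 0, hK, le_rfl, fun g h => ?_⟩
  rw [sub_zero, add_zero]
  by_cases hgh : g = h
  · subst hgh
    simp [twoAdicDist_self, wordDist, hl.one]
  have hne : Multiplicative.toAdd (rotationEquiv g) ≠ Multiplicative.toAdd (rotationEquiv h) :=
    fun e => hgh (rotationEquiv.injective (Multiplicative.toAdd.injective e))
  set x := Multiplicative.toAdd (rotationEquiv (g⁻¹ * h)) with hx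
  have hx' : x = Multiplicative.toAdd (rotationEquiv h) - Multiplicative.toAdd (rotationEquiv g) := by
    rw [hx, map_mul, map_inv, toAdd_mul, toAdd_inv, neg_add_eq_sub]
  have hx0 : x ≠ 0 := by rw [hx']; exact sub_ne_zero.2 hne.symm
  obtain ⟨q, r, m, hq, hr, hqr, hden⟩ := exists_eq_div_of_ne_zero hx0
  have hrot := (rotationEquiv_eq_iff (g⁻¹ * h) q).1 (by rw [← hq]; rfl)
  rw [dyadicPoint, hqr] at hrot
  have hd : twoAdicDist (Multiplicative.toAdd (rotationEquiv g))
      (Multiplicative.toAdd (rotationEquiv h)) = 2 ^ (m + 1) := by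
    rw [twoAdicDist, if_neg hne, ← neg_sub, modDen_neg, ← hx', hden]
    push_cast; rfl
  have h1 := hA _ r (m + 1) hrot
  have h2 := hB _ r m hr hrot
  have hw : wordDist S (g : T) (h : T) = (wordLength S ((g⁻¹ * h : R) : T) : ℝ) := rfl
  simp only
  rw [hd, hw]
  have h1' : (wordLength S ((g⁻¹ * h : R) : T) : ℝ) ≤ A * 2 ^ (m + 1) := by exact_mod_cast h1
  have h2' : (2 : ℝ) ^ m ≤ B * wordLength S ((g⁻¹ * h : R) : T) := by exact_mod_cast h2
  set w : ℝ := ((wordLength S ((g⁻¹ * h : R) : T) : ℕ) : ℝ)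
  have hw0 : 0 ≤ w := Nat.cast_nonneg _
  constructor
  · rw [one_div, inv_mul_le_iff₀ (by linarith), pow_succ]
    have : 0 ≤ (1 + (A : ℝ)) * w := by positivity
    linarith
  · have : 0 ≤ (1 + 2 * (B : ℝ)) * 2 ^ (m + 1) := by positivity
    linarith

end ThompsonT

end

theorem mainTheorem8 :
    Group.FG ThompsonT.T ∧
    ∃ e : ThompsonT.R ≃* Multiplicative ThompsonT.DyadicModOne,
      (∀ (g : ThompsonT.R) (q : ThompsonT.dyadicRationals),
        e g = Multiplicative.ofAdd (q : ThompsonT.DyadicModOne) ↔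
          ∀ x : UnitAddCircle, (g : ThompsonT.T).1 x = x + ThompsonT.dyadicPoint q) ∧
      ∀ S : Set ThompsonT.T, S.Finite → Subgroup.closure S = ⊤ →
        ThompsonT.IsQuasiIsometricEmbedding
          (fun g h : ThompsonT.R =>
            ThompsonT.twoAdicDist (Multiplicative.toAdd (e g)) (Multiplicative.toAdd (e h)))
          (ThompsonT.wordDist S)
          (fun g : ThompsonT.R => (g : ThompsonT.T)) :=
  ⟨ThompsonT.fg_T, ThompsonT.rotationEquiv, ThompsonT.rotationEquiv_eq_iff,
    fun _ hfin hS => ThompsonT.isQuasiIsometricEmbedding_rotation hfin hS⟩
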